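/- **Conventions.** Functions on $\mathbb{R}$ are complex-valued, $\mathcal{S}=\mathcal{S}(\mathbb{R})$ is the Schwartz space, $\widehat f(k)=\int_{\mathbb R} f(\xi)e^{-ik\xi}\,d\xi$, extended to tempered distributions, and for $s\in\mathbb{R}$ the Sobolev space $H^s=H^s(\mathbb{R})$ has the norm $\|f\|_{H^s}^2=\frac1{2\pi}\int_{\mathbb R}(1+k^2)^s|\widehat f(k)|^2\,dk$. For $0<\alpha\le 1$ the spectral fractional derivative $D^\alpha_\xi$ is given by $\widehat{D^\alpha_\xi f}(k)=(ik)^\alpha\widehat f(k)$ (principal branch), and $$D^\alpha_\xi f\cdot g:=(D^\alpha_\xi f)\,g-f\,(D^\alpha_\xi g).$$ For $f,g\in\mathcal S$ this is a function on $\mathbb R$, with the products taken pointwise. For $f,g\in H^s$ with $s>\tfrac12$ the products are those of an element of $H^{s-\alpha}$ and an element of $H^s$: the product $uv$ is the tempered distribution with $\widehat{uv}=\frac1{2\pi}\,\widehat u*\widehat v$. The classical first-order Hirota derivative is $D_\xi f\cdot g:=(\partial_\xi f)\,g-f\,(\partial_\xi g)$, with distributional derivatives and the same product. **Theorem.** Let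 $0<\alpha\le 1$. 1. (Bilinearity) $(f,g)\mapsto D^\alpha_\xi f\cdot g$ is bilinear on $\mathcal S\times\mathcal S$. 2. (Skew-symmetry and diagonal vanishing) $D^\alpha_\xi f\cdot g=-D^\alpha_\xi g\cdot f$ and $D^\alpha_\xi f\cdot f=0$, both for $f,g\in\mathcal S$ and for $f,g\in H^s$ with $s>\tfrac12$. Moreover, for $f,g\in\mathcal S$ the distribution $D^\alpha_\xi f\cdot g$ given by the definition on Sobolev spaces is the one defined by the function $D^\alpha_\xi f\cdot g$. 3. (Sobolev continuity) For every $s>\tfrac12$ there is a constant $C=C(s,\alpha)$ such that for all $f,g\in H^s$ one has $D^\alpha_\xi f\cdot g\in H^{s-\alpha}$ and $$\|D^\alpha_\xi f\cdot g\|_{H^{s-\alpha}}\le C\,\|f\|_{H^s}\,\|g\|_{H^s}.$$ 4. (Classical limit) For every $s>\tfrac12$ and all $f,g\in H^s$, the distributions $D^\alpha_\xi f\cdot g$ ($0<\alpha\le1$) and $D_\xi f\cdot g$ belong to $H^{s-1}$, and $$D^\alpha_\xi f\cdot g\to D_\xi f\cdot g\quad\text{in }H^{s-1}\text{ as }\alpha\to1^-.$$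 -/

import Mathlib

open MeasureTheory Filter Topology
open scoped SchwartzMap FourierTransform

noncomputable section

namespace SpectralHirota

/-- The Fourier transform `f̂(k) = ∫ f(ξ) e^{-ikξ} dξ` (angular frequency convention). -/
def angularFourier (f : ℝ → ℂ) (k : ℝ) : ℂ :=
  ∫ ξ : ℝ, f ξ * Complex.exp (-(Complex.I * k * ξ))

/-- The symbol `(ik)^α`, principal branch. -/
def fracSymbol (α k : ℝ) : ℂ := (Complex.I * (k : ℂ)) ^ (α : ℂ)

/-- The spectral fractional derivative of a Schwartz function: the function with Fourier transform
`(ik)^α f̂(k)`, i.e. `(D^α f)(ξ) = (1/2π) ∫ (ik)^α f̂(k) e^{ikξ} dk`. -/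
def fracDeriv (α : ℝ) (f : 𝓢(ℝ, ℂ)) (ξ : ℝ) : ℂ :=
  (1 / (2 * Real.pi) : ℂ) *
    ∫ k : ℝ, fracSymbol α k * angularFourier f k * Complex.exp (Complex.I * k * ξ)

/-- The spectral fractional Hirota operator on Schwartz functions,
`D^α f·g = (D^α f) g - f (D^α g)`, a function on `ℝ`. -/
def hirota (α : ℝ) (f g : 𝓢(ℝ, ℂ)) : ℝ → ℂ :=
  fun ξ => fracDeriv α f ξ * g ξ - f ξ * fracDeriv α g ξ

/-- The tempered distribution `u` has as its Fourier transform `û` (angular frequency convention)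
the function `U`. In the convention of `𝓕` (kernel `e^{-2πixξ}`) this says `(𝓕 u)(x) = U (2πx)`. -/
def HasFourierDensity (u : 𝓢'(ℝ, ℂ)) (U : ℝ → ℂ) : Prop :=
  ∀ φ : 𝓢(ℝ, ℂ), Integrable (fun x : ℝ => φ x * U (2 * Real.pi * x)) ∧
    𝓕 u φ = ∫ x : ℝ, φ x * U (2 * Real.pi * x)

/-- A tempered distribution is determined by its Fourier transform. -/
theorem HasFourierDensity.unique {u v : 𝓢'(ℝ, ℂ)} {U : ℝ → ℂ}
    (hu : HasFourierDensity u U) (hv : HasFourierDensity v U) : u = v := by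
  have h : 𝓕 u = 𝓕 v := by
    ext φ
    rw [(hu φ).2, (hv φ).2]
  have h2 := congrArg (fun w : 𝓢'(ℝ, ℂ) => (𝓕⁻ w : 𝓢'(ℝ, ℂ))) h
  simpa using h2

/-- The Fourier transform of a tempered distribution is unique as a function, up to null sets. -/
theorem HasFourierDensity.ae_unique {u : 𝓢'(ℝ, ℂ)} {U V : ℝ → ℂ}
    (hU : HasFourierDensity u U) (hV : HasFourierDensity u V) : U =ᵐ[volume] V := by
  have hpi : (2 * Real.pi : ℝ) ≠ 0 := by positivity
  set W : ℝ → ℂ := fun x => U (2 * Real.pi * x) - V (2 * Real.pi * x) with hW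
  have hint : ∀ φ : 𝓢(ℝ, ℂ), Integrable (fun x : ℝ => φ x * W x) := by
    intro φ
    refine ((hU φ).1.sub (hV φ).1).congr (Eventually.of_forall fun x => ?_)
    simp only [Pi.sub_apply, hW]
    ring
  have hzero : ∀ φ : 𝓢(ℝ, ℂ), ∫ x : ℝ, φ x * W x = 0 := by
    intro φ
    have h1 : ∫ x : ℝ, φ x * W x =
        (∫ x : ℝ, φ x * U (2 * Real.pi * x)) - ∫ x : ℝ, φ x * V (2 * Real.pi * x) := by
      rw [← integral_sub (hU φ).1 (hV φ).1]
      refine integral_congr_ae (Eventually.of_forall fun x => ?_)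
      simp only [hW]
      ring
    rw [h1, ← (hU φ).2, ← (hV φ).2, sub_self]
  have hloc : LocallyIntegrable W := by
    intro x
    let b : ContDiffBump x := ⟨1, 2, one_pos, one_lt_two⟩
    have hb₁ : HasCompactSupport (Complex.ofRealCLM ∘ b) := b.hasCompactSupport.comp_left rfl
    have hb₂ : ContDiff ℝ (⊤ : ℕ∞) (Complex.ofRealCLM ∘ b) :=
      Complex.ofRealCLM.contDiff.comp b.contDiff
    refine ⟨Metric.closedBall x 1, Metric.closedBall_mem_nhds x one_pos, ?_⟩
    refine ((hint (hb₁.toSchwartzMap hb₂)).integrableOn).congr_fun ?_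
      Metric.isClosed_closedBall.measurableSet
    intro y hy
    have : b y = 1 := b.one_of_mem_closedBall hy
    simp [this]
  have hae : ∀ᵐ x : ℝ, W x = 0 := by
    refine ae_eq_zero_of_integral_contDiff_smul_eq_zero hloc fun g hg hgs => ?_
    have hb₁ : HasCompactSupport (Complex.ofRealCLM ∘ g) := hgs.comp_left rfl
    have hb₂ : ContDiff ℝ (⊤ : ℕ∞) (Complex.ofRealCLM ∘ g) := Complex.ofRealCLM.contDiff.comp hg
    simpa using hzero (hb₁.toSchwartzMap hb₂)
  have hq := (Measure.quasiMeasurePreserving_smul (volume : Measure ℝ)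
    (inv_ne_zero hpi)).ae hae
  filter_upwards [hq] with k hk
  have hk2 : 2 * Real.pi * ((2 * Real.pi)⁻¹ * k) = k := by field_simp
  simpa only [hW, smul_eq_mul, hk2, sub_eq_zero] using hk

/-- The Fourier transform of a Schwartz function is the expected one. -/
theorem hasFourierDensity_schwartz (f : 𝓢(ℝ, ℂ)) :
    HasFourierDensity (f : 𝓢'(ℝ, ℂ)) (angularFourier f) := by
  have key : ∀ x : ℝ, angularFourier f (2 * Real.pi * x) = (𝓕 f : 𝓢(ℝ, ℂ)) x := by
    intro x
    rw [SchwartzMap.fourier_coe, Real.fourier_real_eq_integral_exp_smul, angularFourier]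
    refine integral_congr_ae (Eventually.of_forall fun ξ => ?_)
    simp only [smul_eq_mul]
    rw [mul_comm]
    congr 2
    push_cast
    ring
  intro φ
  simp only [key]
  constructor
  · exact (SchwartzMap.pairing (ContinuousLinearMap.mul ℂ ℂ) φ (𝓕 f)).integrable
  · rw [TemperedDistribution.fourier_toTemperedDistributionCLM_eq, SchwartzMap.coe_apply]
    simp

open Classical in
/-- The Fourier transform `û` as a function, for `u` whose Fourier transform is a function
(`0` otherwise). -/
def fourierDensity (u : 𝓢'(ℝ, ℂ)) : ℝ → ℂ :=
  if h : ∃ U, HasFourierDensity u U then h.choose else 0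

open Classical in
/-- The tempered distribution with Fourier transform the function `U`, if there is one
(`0` otherwise). -/
def ofFourierDensity (U : ℝ → ℂ) : 𝓢'(ℝ, ℂ) :=
  if h : ∃ u, HasFourierDensity u U then h.choose else 0

/-- The Sobolev norm, `‖u‖_{H^s}² = (1/2π) ∫ (1 + k²)^s |û(k)|² dk`. Membership in `H^s(ℝ)` is
`TemperedDistribution.MemSobolev s 2`, which asks for the same integral to be finite, with the
equivalent weight `(1 + (k/2π)²)^s`. -/
def sobolevNorm (s : ℝ) (u : 𝓢'(ℝ, ℂ)) : ℝ :=
  Real.sqrt (1 / (2 * Real.pi) * ∫ k : ℝ, (1 + k ^ 2) ^ s * ‖fourierDensity u k‖ ^ 2)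

/-- The spectral fractional derivative on Sobolev spaces: multiplication of `û` by `(ik)^α`. -/
def fracDerivDist (α : ℝ) (u : 𝓢'(ℝ, ℂ)) : 𝓢'(ℝ, ℂ) :=
  ofFourierDensity fun k => fracSymbol α k * fourierDensity u k

/-- The product of `u ∈ H^t(ℝ)` and `v ∈ H^s(ℝ)`, `s + t ≥ 0`: the distribution with Fourier
transform `(1/2π) (û ∗ v̂)`. -/
def mulDist (u v : 𝓢'(ℝ, ℂ)) : 𝓢'(ℝ, ℂ) :=
  ofFourierDensity fun k =>
    (1 / (2 * Real.pi) : ℂ) * ∫ l : ℝ, fourierDensity u (k - l) * fourierDensity v l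

/-- The spectral fractional Hirota operator on Sobolev spaces,
`D^α f·g = (D^α f) g - f (D^α g)`. -/
def hirotaDist (α : ℝ) (f g : 𝓢'(ℝ, ℂ)) : 𝓢'(ℝ, ℂ) :=
  mulDist (fracDerivDist α f) g - mulDist f (fracDerivDist α g)

/-- The classical first-order Hirota derivative `D f·g = f' g - f g'`, with distributional
derivatives. -/
def classicalHirota (f g : 𝓢'(ℝ, ℂ)) : 𝓢'(ℝ, ℂ) :=
  mulDist (TemperedDistribution.derivCLM ℂ f) g - mulDist f (TemperedDistribution.derivCLM ℂ g)

end SpectralHirota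

end

open SpectralHirota TemperedDistribution

namespace SpectralHirota

/-! ### The weights `(1 + k²)^(t/2)` -/

/-! On the Fourier side the operator consists of multiplications and convolutions. An element of H^t
is a distribution whose transform U satisfies (1 + k²)^(t/2) U ∈ L². The symbol (ik)^α has modulus
|k|^α ≤ (1 + k²)^(α/2), so D^α maps H^s to H^(s-α) with norm at most one (`fracDerivDist_spec`,
`sobolevNorm_fracDerivDist_le`).

Continuity thus reduces to the product estimate H^t × H^s → H^t for s > 1/2 and |t| ≤ s
(`exists_sobolevNorm_mulDist_le`), used with t = s - α; here |s - α| ≤ s because α ≤ 1 < 2s. Among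
the frequencies k, k - l and l, the two largest are comparable. Hence the weight of order t at k is
bounded by the weights of the two factors times a sum of weights of order -s at the three
frequencies (`sobWeight_le`). These are square integrable since s > 1/2, and Cauchy-Schwarz with
Tonelli concludes (`lintegral_sq_conv_le`).

Skew-symmetry is commutativity of convolution. For the classical limit, D = D^1, and the difference
of the two operators is a combination of products with (D^α - D^1)f and (D^α - D^1)g. The product
estimate at the fixed order t = s - 1 reduces the claim to convergence of these factors, which is
dominated convergence (`tendsto_sobolevNorm_fracDerivDist_sub`).

For Schwartz functions all densities are integrable, so the convolution theorem
(`angularFourierInv_convDensity`) identifies the distributional product with the pointwise one. -/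

/-- The weight `(1 + k²)^(t/2)`. -/
noncomputable def sobWeight (t k : ℝ) : ℝ := (1 + k ^ 2) ^ (t / 2)

theorem sobWeight_pos (t k : ℝ) : 0 < sobWeight t k := by
  unfold sobWeight; positivity

theorem sobWeight_add (s t k : ℝ) : sobWeight (s + t) k = sobWeight s k * sobWeight t k := by
  unfold sobWeight
  rw [← Real.rpow_add (by positivity)]
  ring_nf

theorem sobWeight_neg (t k : ℝ) : sobWeight (-t) k = (sobWeight t k)⁻¹ := by
  unfold sobWeight
  rw [← Real.rpow_neg (by positivity)]
  ring_nf

theorem sobWeight_sq (t k : ℝ) : sobWeight t k ^ 2 = (1 + k ^ 2) ^ t := by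
  unfold sobWeight
  rw [← Real.rpow_natCast, ← Real.rpow_mul (by positivity)]
  norm_num

theorem sobWeight_mono {s t : ℝ} (h : s ≤ t) (k : ℝ) : sobWeight s k ≤ sobWeight t k :=
  Real.rpow_le_rpow_of_exponent_le (by nlinarith [sq_nonneg k]) (by linarith)

theorem continuous_sobWeight (t : ℝ) : Continuous (sobWeight t) := by
  unfold sobWeight
  exact Continuous.rpow_const (by fun_prop) fun k => Or.inl (by positivity)

theorem hasTemperateGrowth_sobWeight (t : ℝ) :
    (fun k : ℝ => (sobWeight t k : ℂ)).HasTemperateGrowth := by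
  have h := Function.hasTemperateGrowth_one_add_norm_sq_rpow ℝ (t / 2)
  have h2 : sobWeight t = fun x : ℝ => (1 + ‖x‖ ^ 2) ^ (t / 2) := by
    ext x; simp [sobWeight]
  have := h2 ▸ h
  fun_prop

/-- Powers of comparable numbers are comparable. -/
theorem rpow_le_const_mul_rpow {x y K p q : ℝ} (hx : 0 < x) (hy : 0 < y) (hK : 1 ≤ K)
    (hxy : x ≤ K * y) (hyx : y ≤ K * x) (hpq : |p| ≤ q) : x ^ p ≤ K ^ q * y ^ p := by
  have hKp : ∀ r, |r| ≤ q → K ^ r ≤ K ^ q := fun r hr =>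
    Real.rpow_le_rpow_of_exponent_le hK ((le_abs_self r).trans hr)
  rcases le_total 0 p with hp | hp
  · calc x ^ p ≤ (K * y) ^ p := Real.rpow_le_rpow hx.le hxy hp
      _ = K ^ p * y ^ p := Real.mul_rpow (by linarith) hy.le
      _ ≤ _ := mul_le_mul_of_nonneg_right (hKp p hpq) (by positivity)
  · calc x ^ p ≤ (K⁻¹ * y) ^ p := by
          refine Real.rpow_le_rpow_of_nonpos (by positivity) ?_ hp
          rw [inv_mul_le_iff₀ (by linarith)]; exact hyx
      _ = K ^ (-p) * y ^ p := by
          rw [Real.mul_rpow (by positivity) hy.le, Real.inv_rpow (by linarith),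
            Real.rpow_neg (by linarith)]
      _ ≤ _ := mul_le_mul_of_nonneg_right (hKp (-p) (by rwa [abs_neg])) (by positivity)

/-- A product estimate for three numbers each of which is controlled by the sum of the others. -/
theorem rpow_le_of_triangle {x y z p q : ℝ} (hx : 0 < x) (hy : 0 < y) (hz : 0 < z)
    (hxyz : x ≤ 2 * (y + z)) (hyxz : y ≤ 2 * (x + z)) (hzxy : z ≤ 2 * (x + y)) (hpq : |p| ≤ q) :
    x ^ p ≤ 4 ^ q * (y ^ p * z ^ q * (z ^ (-q) + y ^ (-q) + x ^ (-q))) := by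
  have hp1 : p ≤ q := (le_abs_self p).trans hpq
  have hp2 : -p ≤ q := (neg_le_abs p).trans hpq
  have hX : 0 < x ^ (-q) := by positivity
  have hY : 0 < y ^ (-q) := by positivity
  have hZ : 0 < z ^ (-q) := by positivity
  have key : ∀ w, 0 ≤ w → w ≤ z ^ (-q) + y ^ (-q) + x ^ (-q) → x ^ p ≤ 4 ^ q * (y ^ p * z ^ q * w) →
      x ^ p ≤ 4 ^ q * (y ^ p * z ^ q * (z ^ (-q) + y ^ (-q) + x ^ (-q))) := by
    intro w _ hw h
    refine h.trans ?_
    gcongr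
  -- Split by the smallest of the three numbers: the other two agree up to a factor 4, and only the
  -- summand belonging to the smallest one is kept.
  by_cases hzmin : z ≤ x ∧ z ≤ y
  · refine key (z ^ (-q)) hZ.le (by linarith) ?_
    have h := rpow_le_const_mul_rpow (K := 4) hx hy (by norm_num) (by linarith) (by linarith) hpq
    have e : z ^ q * z ^ (-q) = 1 := by rw [← Real.rpow_add hz]; simp
    calc x ^ p ≤ 4 ^ q * y ^ p := h
      _ = 4 ^ q * (y ^ p * (z ^ q * z ^ (-q))) := by rw [e, mul_one]
      _ = _ := by ring
  by_cases hymin : y ≤ x ∧ y ≤ z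
  · refine key (y ^ (-q)) hY.le (by linarith) ?_
    have h := rpow_le_const_mul_rpow (K := 4) hx hz (by norm_num) (by linarith) (by linarith) hpq
    -- The right-hand side is z^p (z/y)^(q-p) up to the constant, so p ≤ q and y ≤ z suffice.
    have h2 : y ^ (q - p) ≤ z ^ (q - p) := Real.rpow_le_rpow hy.le hymin.2 (by linarith)
    have e : z ^ q = z ^ p * z ^ (q - p) := by rw [← Real.rpow_add hz]; ring_nf
    have e2 : y ^ p * y ^ (-q) * y ^ (q - p) = 1 := by
      rw [← Real.rpow_add hy, ← Real.rpow_add hy]; ring_nf; simp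
    calc x ^ p ≤ 4 ^ q * z ^ p := h
      _ = 4 ^ q * (z ^ p * (y ^ p * y ^ (-q) * y ^ (q - p))) := by rw [e2, mul_one]
      _ ≤ 4 ^ q * (z ^ p * (y ^ p * y ^ (-q) * z ^ (q - p))) := by gcongr
      _ = _ := by rw [e]; ring
  · have hxy : x ≤ y := by
      by_contra! h
      rcases le_total y z with h1 | h1
      · exact hymin ⟨h.le, h1⟩
      · exact hzmin ⟨h1.trans h.le, h1⟩
    have hxz : x ≤ z := by
      by_contra! h
      rcases le_total y z with h1 | h1
      · exact hymin ⟨h1.trans h.le, h1⟩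
      · exact hzmin ⟨h.le, h1⟩
    refine key (x ^ (-q)) hX.le (by linarith) ?_
    have h := rpow_le_const_mul_rpow (K := 4) hz hy (by norm_num) (by linarith) (by linarith) hpq
    -- The right-hand side is comparable to z^(p+q) x^(-q), so -q ≤ p and x ≤ z suffice.
    have h2 : x ^ (p + q) ≤ z ^ (p + q) := Real.rpow_le_rpow hx.le hxz (by linarith)
    have e : x ^ p = x ^ (p + q) * x ^ (-q) := by rw [← Real.rpow_add hx]; ring_nf
    rw [e]
    calc x ^ (p + q) * x ^ (-q) ≤ z ^ (p + q) * x ^ (-q) := by gcongr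
      _ = z ^ p * z ^ q * x ^ (-q) := by rw [Real.rpow_add hz]
      _ ≤ (4 ^ q * y ^ p) * z ^ q * x ^ (-q) := by gcongr
      _ = _ := by ring

/-- The identity k = (k - l) + l makes each of 1 + k², 1 + (k - l)², 1 + l² at most twice the sum of
the other two. In the last factor every term has order -s, which is what Cauchy-Schwarz needs later.
-/
theorem sobWeight_le (t s : ℝ) (hts : |t| ≤ s) (k l : ℝ) :
    sobWeight t k ≤ 4 ^ (s / 2) * (sobWeight t (k - l) * sobWeight s l *
      (sobWeight (-s) l + sobWeight (-s) (k - l) + sobWeight (-s) k)) := by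
  have h := rpow_le_of_triangle (x := 1 + k ^ 2) (y := 1 + (k - l) ^ 2) (z := 1 + l ^ 2)
    (p := t / 2) (q := s / 2) (by positivity) (by positivity) (by positivity)
    (by nlinarith [sq_nonneg (k - 2 * l)])
    (by nlinarith [sq_nonneg (k + l)])
    (by nlinarith [sq_nonneg (2 * k - l)])
    (by rw [abs_div, abs_two]; linarith)
  simpa only [sobWeight, neg_div] using h

/-- Rescaling changes the weight by a bounded factor. -/
theorem sobWeight_scale_le (t c : ℝ) (hc : 1 ≤ c) (k : ℝ) :
    sobWeight t k ≤ (c ^ 2) ^ (|t| / 2) * sobWeight t (c * k) ∧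
      sobWeight t (c * k) ≤ (c ^ 2) ^ (|t| / 2) * sobWeight t k := by
  have hc2 : 1 ≤ c ^ 2 := by nlinarith
  have h1 : 1 + k ^ 2 ≤ c ^ 2 * (1 + (c * k) ^ 2) := by
    nlinarith [mul_nonneg (sub_nonneg.2 hc2) (sq_nonneg k), sq_nonneg (c * k),
      mul_nonneg (sub_nonneg.2 hc2) (sq_nonneg (c * k))]
  have h2 : 1 + (c * k) ^ 2 ≤ c ^ 2 * (1 + k ^ 2) := by nlinarith
  have h3 : |t / 2| ≤ |t| / 2 := by rw [abs_div, abs_two]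
  exact ⟨rpow_le_const_mul_rpow (by positivity) (by positivity) hc2 h1 h2 h3,
    rpow_le_const_mul_rpow (by positivity) (by positivity) hc2 h2 h1 h3⟩

/-! ### Sobolev functions and their Fourier densities -/

/-- The function `(1 + k²)^(t/2) U(k)`. -/
noncomputable def weighted (t : ℝ) (U : ℝ → ℂ) (k : ℝ) : ℂ := (sobWeight t k : ℂ) * U k

theorem norm_weighted (t : ℝ) (U : ℝ → ℂ) (k : ℝ) : ‖weighted t U k‖ = sobWeight t k * ‖U k‖ := by
  rw [weighted, norm_mul, Complex.norm_real, Real.norm_of_nonneg (sobWeight_pos t k).le]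

theorem weighted_weighted (s t : ℝ) (U : ℝ → ℂ) :
    weighted s (weighted t U) = weighted (s + t) U := by
  ext k
  simp only [weighted, sobWeight_add]
  push_cast
  ring

theorem weighted_zero (U : ℝ → ℂ) : weighted 0 U = U := by
  ext k; simp [weighted, sobWeight]

theorem aestronglyMeasurable_weighted {t : ℝ} {U : ℝ → ℂ} (hU : AEStronglyMeasurable U) :
    AEStronglyMeasurable (weighted t U) :=
  (Complex.continuous_ofReal.comp (continuous_sobWeight t)).aestronglyMeasurable.mul hU

theorem aestronglyMeasurable_of_memLp_weighted {t : ℝ} {U : ℝ → ℂ} (hU : MemLp (weighted t U) 2) :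
    AEStronglyMeasurable U := by
  have := aestronglyMeasurable_weighted (t := -t) hU.1
  rwa [weighted_weighted, neg_add_cancel, weighted_zero] at this

theorem aestronglyMeasurable_comp_mul {g : ℝ → ℂ} (hg : AEStronglyMeasurable g) {c : ℝ}
    (hc : c ≠ 0) : AEStronglyMeasurable fun x => g (c * x) :=
  hg.comp_quasiMeasurePreserving (Measure.quasiMeasurePreserving_smul volume hc)

theorem memLp_two_comp_mul {g : ℝ → ℂ} (hg : MemLp g 2) {c : ℝ} (hc : c ≠ 0) :
    MemLp (fun x => g (c * x)) 2 := by
  have h1 := aestronglyMeasurable_comp_mul hg.1 hc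
  rw [memLp_two_iff_integrable_sq_norm h1]
  exact ((memLp_two_iff_integrable_sq_norm hg.1).1 hg).comp_mul_left' hc

theorem one_le_two_pi : (1 : ℝ) ≤ 2 * Real.pi := by linarith [Real.pi_gt_three]

theorem two_pi_ne_zero : (2 * Real.pi : ℝ) ≠ 0 := by positivity

/-- A function with `(1 + k²)^(t/2) U ∈ L²` is the Fourier transform of an element of `H^t`. -/
theorem exists_hasFourierDensity {t : ℝ} {U : ℝ → ℂ} (hU : MemLp (weighted t U) 2) :
    ∃ u : 𝓢'(ℝ, ℂ), HasFourierDensity u U ∧ MemSobolev t 2 u := by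
  have hc := two_pi_ne_zero
  have h1 : MemLp (weighted t fun x => U (2 * Real.pi * x)) 2 := by
    refine (memLp_two_comp_mul hU hc).of_le_mul (c := ((2 * Real.pi) ^ 2) ^ (|t| / 2))
      (aestronglyMeasurable_weighted (aestronglyMeasurable_comp_mul
        (aestronglyMeasurable_of_memLp_weighted hU) hc)) (Eventually.of_forall fun x => ?_)
    rw [norm_weighted, norm_weighted, ← mul_assoc]
    gcongr
    exact (sobWeight_scale_le t _ one_le_two_pi x).1
  set F : Lp ℂ 2 (volume : Measure ℝ) := h1.toLp _
  have hF : ∀ᵐ x, F x = weighted t (fun x => U (2 * Real.pi * x)) x := h1.coeFn_toLp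
  -- `MemSobolev` weighs the ordinary frequency x = k/2π, so the rescaled L² function is `F`;
  -- dividing it by the weight recovers U(2πx).
  refine ⟨𝓕⁻ (smulLeftCLM ℂ (fun x : ℝ => (sobWeight (-t) x : ℂ)) (F : 𝓢'(ℝ, ℂ))), ?_, ?_⟩
  · intro φ
    have e : ∀ᵐ x, (SchwartzMap.smulLeftCLM ℂ (fun x : ℝ => (sobWeight (-t) x : ℂ)) φ) x * F x =
        φ x * U (2 * Real.pi * x) := by
      filter_upwards [hF] with x hx
      rw [SchwartzMap.smulLeftCLM_apply_apply (hasTemperateGrowth_sobWeight _), hx, weighted,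
        sobWeight_neg]
      have : (sobWeight t x : ℂ) ≠ 0 := by exact_mod_cast (sobWeight_pos t x).ne'
      push_cast
      rw [smul_eq_mul]
      field_simp
    constructor
    · refine Integrable.congr ?_ e
      exact (SchwartzMap.memLp (μ := volume) _ 2).integrable_mul (Lp.memLp F)
    · rw [FourierTransform.fourier_fourierInv_eq, smulLeftCLM_apply_apply,
        Lp.toTemperedDistribution_apply]
      exact integral_congr_ae e
  · rw [memSobolev_iff_exists_smulLeftCLM_fourier]
    refine ⟨F, ?_⟩
    have e : (fun x : ℝ => (((1 + ‖x‖ ^ 2) ^ (t / 2) : ℝ) : ℂ)) = fun x => (sobWeight t x : ℂ) := by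
      ext x; simp [sobWeight]
    rw [e, FourierTransform.fourier_fourierInv_eq,
      smulLeftCLM_smulLeftCLM_apply (hasTemperateGrowth_sobWeight _)
        (hasTemperateGrowth_sobWeight _)]
    have e2 : ((fun x : ℝ => (sobWeight (-t) x : ℂ)) * fun x => (sobWeight t x : ℂ)) =
        fun _ => 1 := by
      ext x
      have : (sobWeight t x : ℂ) ≠ 0 := by exact_mod_cast (sobWeight_pos t x).ne'
      simp [sobWeight_neg, this]
    rw [e2]
    simp

/-- Converse of `exists_hasFourierDensity`: the weight is a smooth multiplier of temperate growth
with an inverse of the same kind, so it can be divided out of the L² function, and the variable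
rescaled to angular frequency. -/
theorem MemSobolev.exists_density {t : ℝ} {u : 𝓢'(ℝ, ℂ)} (hu : MemSobolev t 2 u) :
    ∃ U : ℝ → ℂ, HasFourierDensity u U ∧ MemLp (weighted t U) 2 := by
  obtain ⟨F, hF⟩ := memSobolev_iff_exists_smulLeftCLM_fourier.1 hu
  have e : (fun x : ℝ => (((1 + ‖x‖ ^ 2) ^ (t / 2) : ℝ) : ℂ)) = fun x => (sobWeight t x : ℂ) := by
    ext x; simp [sobWeight]
  rw [e] at hF
  have hc := two_pi_ne_zero
  have hc' := inv_ne_zero hc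
  have hcancel : ∀ x, (2 * Real.pi)⁻¹ * (2 * Real.pi * x) = x := fun x => by field_simp
  have hcancel' : ∀ x, (2 * Real.pi) * ((2 * Real.pi)⁻¹ * x) = x := fun x => by field_simp
  refine ⟨fun k => weighted (-t) F ((2 * Real.pi)⁻¹ * k), ?_, ?_⟩
  · intro φ
    have e2 : ∀ x, (SchwartzMap.smulLeftCLM ℂ (fun x : ℝ => (sobWeight (-t) x : ℂ)) φ) x * F x =
        φ x * weighted (-t) F x := by
      intro x
      rw [SchwartzMap.smulLeftCLM_apply_apply (hasTemperateGrowth_sobWeight _), weighted,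
        smul_eq_mul]
      ring
    simp only [hcancel]
    constructor
    · refine Integrable.congr ?_ (Eventually.of_forall e2)
      exact (SchwartzMap.memLp (μ := volume) _ 2).integrable_mul (Lp.memLp F)
    -- Factoring the test function as weight times inverse weight lets the weight pass to `𝓕 u`,
    -- where it produces `F`.
    · have e3 : φ = SchwartzMap.smulLeftCLM ℂ (fun x : ℝ => (sobWeight t x : ℂ))
          (SchwartzMap.smulLeftCLM ℂ (fun x : ℝ => (sobWeight (-t) x : ℂ)) φ) := by
        ext x
        rw [SchwartzMap.smulLeftCLM_apply_apply (hasTemperateGrowth_sobWeight _),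
          SchwartzMap.smulLeftCLM_apply_apply (hasTemperateGrowth_sobWeight _)]
        have : (sobWeight t x : ℂ) ≠ 0 := by exact_mod_cast (sobWeight_pos t x).ne'
        simp [sobWeight_neg, this]
      conv_lhs => rw [e3]
      rw [← smulLeftCLM_apply_apply, hF, Lp.toTemperedDistribution_apply]
      exact integral_congr_ae (Eventually.of_forall e2)
  · have h1 : MemLp F 2 := Lp.memLp F
    refine (memLp_two_comp_mul h1 hc').of_le_mul (c := ((2 * Real.pi) ^ 2) ^ (|t| / 2))
      (aestronglyMeasurable_weighted (aestronglyMeasurable_comp_mul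
        (aestronglyMeasurable_weighted h1.1) hc')) (Eventually.of_forall fun x => ?_)
    rw [norm_weighted, norm_weighted, ← mul_assoc]
    gcongr
    have h := (sobWeight_scale_le t _ one_le_two_pi ((2 * Real.pi)⁻¹ * x)).2
    rw [hcancel'] at h
    rw [sobWeight_neg]
    exact (mul_inv_le_iff₀ (sobWeight_pos _ _)).2 h

/-- The Fourier transform of a distribution is its `fourierDensity`, if it is a function. -/
theorem HasFourierDensity.fourierDensity {u : 𝓢'(ℝ, ℂ)} {U : ℝ → ℂ} (h : HasFourierDensity u U) :
    HasFourierDensity u (fourierDensity u) := by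
  have h' : ∃ U, HasFourierDensity u U := ⟨U, h⟩
  rw [SpectralHirota.fourierDensity, dif_pos h']
  exact h'.choose_spec

theorem HasFourierDensity.fourierDensity_ae {u : 𝓢'(ℝ, ℂ)} {U : ℝ → ℂ}
    (h : HasFourierDensity u U) : SpectralHirota.fourierDensity u =ᵐ[volume] U :=
  h.fourierDensity.ae_unique h

theorem HasFourierDensity.ofFourierDensity_eq {u : 𝓢'(ℝ, ℂ)} {U : ℝ → ℂ}
    (h : HasFourierDensity u U) : ofFourierDensity U = u := by
  have h' : ∃ u, HasFourierDensity u U := ⟨u, h⟩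
  rw [ofFourierDensity, dif_pos h']
  exact h'.choose_spec.unique h

theorem HasFourierDensity.congr {u : 𝓢'(ℝ, ℂ)} {U V : ℝ → ℂ} (h : HasFourierDensity u U)
    (hUV : U =ᵐ[volume] V) : HasFourierDensity u V := by
  have h2 : ∀ᵐ x : ℝ, U (2 * Real.pi * x) = V (2 * Real.pi * x) :=
    (Measure.quasiMeasurePreserving_smul (volume : Measure ℝ) two_pi_ne_zero).ae hUV
  intro φ
  have h3 : ∀ᵐ x : ℝ, φ x * U (2 * Real.pi * x) = φ x * V (2 * Real.pi * x) := by
    filter_upwards [h2] with x hx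
    rw [hx]
  exact ⟨(h φ).1.congr h3, (h φ).2.trans (integral_congr_ae h3)⟩

theorem HasFourierDensity.sub {u v : 𝓢'(ℝ, ℂ)} {U V : ℝ → ℂ} (hu : HasFourierDensity u U)
    (hv : HasFourierDensity v V) : HasFourierDensity (u - v) (U - V) := by
  intro φ
  have e : (fun x => φ x * (U - V) (2 * Real.pi * x)) =
      (fun x => φ x * U (2 * Real.pi * x)) - fun x => φ x * V (2 * Real.pi * x) := by
    ext x; simp [mul_sub]
  rw [e]
  refine ⟨(hu φ).1.sub (hv φ).1, ?_⟩
  have e2 : 𝓕 (u - v) φ = 𝓕 u φ - 𝓕 v φ := rfl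
  rw [e2, (hu φ).2, (hv φ).2, ← integral_sub (hu φ).1 (hv φ).1]
  rfl

theorem weighted_congr_ae {t : ℝ} {U V : ℝ → ℂ} (h : U =ᵐ[volume] V) :
    weighted t U =ᵐ[volume] weighted t V := by
  filter_upwards [h] with x hx
  simp [weighted, hx]

theorem memSobolev_iff_of_hasFourierDensity {t : ℝ} {u : 𝓢'(ℝ, ℂ)} {U : ℝ → ℂ}
    (h : HasFourierDensity u U) : MemSobolev t 2 u ↔ MemLp (weighted t U) 2 := by
  constructor
  · intro hu
    obtain ⟨V, hV, hV2⟩ := MemSobolev.exists_density hu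
    exact hV2.ae_eq (weighted_congr_ae (hV.ae_unique h))
  · intro hU
    obtain ⟨v, hv, hv2⟩ := exists_hasFourierDensity hU
    rwa [h.unique hv]

theorem MemSobolev.hasFourierDensity {t : ℝ} {u : 𝓢'(ℝ, ℂ)} (hu : MemSobolev t 2 u) :
    HasFourierDensity u (fourierDensity u) :=
  (MemSobolev.exists_density hu).choose_spec.1.fourierDensity

theorem MemSobolev.memLp_weighted {t : ℝ} {u : 𝓢'(ℝ, ℂ)} (hu : MemSobolev t 2 u) :
    MemLp (weighted t (fourierDensity u)) 2 :=
  (memSobolev_iff_of_hasFourierDensity (MemSobolev.hasFourierDensity hu)).1 hu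

/-- A function with `(1 + k²)^(t/2) U ∈ L²` is the Fourier transform of `ofFourierDensity U`. -/
theorem hasFourierDensity_ofFourierDensity {t : ℝ} {U : ℝ → ℂ} (hU : MemLp (weighted t U) 2) :
    HasFourierDensity (ofFourierDensity U) U ∧ MemSobolev t 2 (ofFourierDensity U) := by
  obtain ⟨u, hu, hu2⟩ := exists_hasFourierDensity hU
  rw [hu.ofFourierDensity_eq]
  exact ⟨hu, hu2⟩

/-! ### The Sobolev norm -/

/-- The Sobolev norm is a multiple of the `L²` norm of the weighted Fourier transform. -/
theorem sobolevNorm_eq {t : ℝ} {u : 𝓢'(ℝ, ℂ)} {U : ℝ → ℂ} (h : HasFourierDensity u U)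
    (hU : MemLp (weighted t U) 2) :
    sobolevNorm t u = Real.sqrt (1 / (2 * Real.pi)) * (eLpNorm (weighted t U) 2).toReal := by
  rw [sobolevNorm, Real.sqrt_mul (by positivity),
    eLpNorm_congr_ae (weighted_congr_ae h.fourierDensity_ae.symm)]
  congr 1
  have hU' : MemLp (weighted t (fourierDensity u)) 2 :=
    hU.ae_eq (weighted_congr_ae h.fourierDensity_ae.symm)
  rw [hU'.eLpNorm_eq_integral_rpow_norm (by norm_num) (by norm_num), ENNReal.toReal_ofReal
    (by positivity), Real.sqrt_eq_rpow]
  simp only [ENNReal.toReal_ofNat, Real.rpow_two, norm_weighted, mul_pow, sobWeight_sq]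
  norm_num

theorem sobolevNorm_nonneg (t : ℝ) (u : 𝓢'(ℝ, ℂ)) : 0 ≤ sobolevNorm t u := Real.sqrt_nonneg _

theorem sobolevNorm_sub_le {t : ℝ} {u v : 𝓢'(ℝ, ℂ)} (hu : MemSobolev t 2 u)
    (hv : MemSobolev t 2 v) :
    sobolevNorm t (u - v) ≤ sobolevNorm t u + sobolevNorm t v := by
  have hu1 := MemSobolev.hasFourierDensity hu
  have hv1 := MemSobolev.hasFourierDensity hv
  have hu2 := MemSobolev.memLp_weighted hu
  have hv2 := MemSobolev.memLp_weighted hv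
  have e : weighted t (fourierDensity u - fourierDensity v) =
      weighted t (fourierDensity u) - weighted t (fourierDensity v) := by
    ext x; simp [weighted, mul_sub]
  rw [sobolevNorm_eq (hu1.sub hv1) (by rw [e]; exact hu2.sub hv2), sobolevNorm_eq hu1 hu2,
    sobolevNorm_eq hv1 hv2, ← mul_add, e, ← ENNReal.toReal_add hu2.2.ne hv2.2.ne]
  gcongr
  · exact (ENNReal.add_lt_top.2 ⟨hu2.2, hv2.2⟩).ne
  · exact eLpNorm_sub_le hu2.1 hv2.1 (by norm_num)

/-! ### Products -/

open scoped ENNReal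

theorem lintegral_mul_sq_le {f g : ℝ → ℝ≥0∞} (hf : AEMeasurable f) (hg : AEMeasurable g) :
    (∫⁻ x, f x * g x) ^ 2 ≤ (∫⁻ x, f x ^ 2) * ∫⁻ x, g x ^ 2 := by
  have h := ENNReal.lintegral_mul_le_Lp_mul_Lq volume Real.HolderConjugate.two_two hf hg
  have hsq : ∀ x : ℝ≥0∞, (x ^ (1 / 2 : ℝ)) ^ 2 = x := fun x => by
    rw [← ENNReal.rpow_natCast, ← ENNReal.rpow_mul]; norm_num
  calc (∫⁻ x, f x * g x) ^ 2 ≤ _ := pow_le_pow_left₀ zero_le h 2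
    _ = _ := by rw [mul_pow, hsq, hsq]; simp only [ENNReal.rpow_two]

theorem ennreal_add_sq_le (x y : ℝ≥0∞) : (x + y) ^ 2 ≤ 4 * (x ^ 2 + y ^ 2) := by
  have key : ∀ x y : ℝ≥0∞, x ≤ y → (x + y) ^ 2 ≤ 4 * (x ^ 2 + y ^ 2) := fun x y h =>
    calc (x + y) ^ 2 ≤ (y + y) ^ 2 := by gcongr
      _ = 4 * y ^ 2 := by ring
      _ ≤ _ := by gcongr; exact le_add_self
  rcases le_total x y with h | h
  · exact key x y h
  · rw [add_comm x, add_comm (x ^ 2)]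
    exact key y x h

/-- A weighted form of Young's inequality, for nonnegative functions. -/
theorem lintegral_sq_conv_le {a b c : ℝ → ℝ≥0∞} (ha : AEMeasurable a) (hb : AEMeasurable b)
    (hc : AEMeasurable c) :
    ∫⁻ k, ((∫⁻ l, (c l + c (k - l)) * (a (k - l) * b l)) + c k * ∫⁻ l, a (k - l) * b l) ^ 2 ≤
      36 * (∫⁻ k, c k ^ 2) * ((∫⁻ k, a k ^ 2) * ∫⁻ k, b k ^ 2) := by
  have hsub : ∀ k : ℝ, ∀ {f : ℝ → ℝ≥0∞}, AEMeasurable f → AEMeasurable fun l => f (k - l) :=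
    fun k f hf => hf.comp_quasiMeasurePreserving
      (Measure.measurePreserving_sub_left volume k).quasiMeasurePreserving
  -- Tonelli and translation invariance.
  have hconv : ∫⁻ k, ∫⁻ l, (a (k - l) * b l) ^ 2 = (∫⁻ k, a k ^ 2) * ∫⁻ k, b k ^ 2 := by
    have hmeas : AEMeasurable (fun p : ℝ × ℝ => (a (p.1 - p.2) * b p.2) ^ 2)
        (volume.prod volume) := by
      refine ((ha.comp_quasiMeasurePreserving ?_).mul
        (hb.comp_quasiMeasurePreserving Measure.quasiMeasurePreserving_snd)).pow_const 2
      exact quasiMeasurePreserving_sub volume volume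
    rw [lintegral_lintegral_swap hmeas]
    simp_rw [mul_pow]
    have : ∀ l, ∫⁻ k, a (k - l) ^ 2 * b l ^ 2 = (∫⁻ k, a k ^ 2) * b l ^ 2 := fun l => by
      rw [lintegral_sub_right_eq_self (fun k => a k ^ 2 * b l ^ 2) l,
        lintegral_mul_const'' _ (ha.pow_const 2)]
    simp_rw [this]
    rw [lintegral_const_mul'' _ (hb.pow_const 2)]
  set S := ∫⁻ k, c k ^ 2 with hS
  set M := (∫⁻ k, a k ^ 2) * ∫⁻ k, b k ^ 2 with hM
  -- Cauchy-Schwarz in l separates c from the product a·b, which is then integrated over k by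
  -- `hconv`.
  have h1 : ∀ k, (∫⁻ l, (c l + c (k - l)) * (a (k - l) * b l)) ^ 2 ≤
      8 * S * ∫⁻ l, (a (k - l) * b l) ^ 2 := by
    intro k
    have h : (∫⁻ l, (c l + c (k - l)) * (a (k - l) * b l)) ^ 2 ≤
        (∫⁻ l, (c l + c (k - l)) ^ 2) * ∫⁻ l, (a (k - l) * b l) ^ 2 :=
      lintegral_mul_sq_le (hc.add (hsub k hc)) ((hsub k ha).mul hb)
    refine h.trans ?_
    gcongr
    calc ∫⁻ l, (c l + c (k - l)) ^ 2 ≤ ∫⁻ l, 4 * (c l ^ 2 + c (k - l) ^ 2) :=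
          lintegral_mono fun l => ennreal_add_sq_le _ _
      _ = 4 * (S + S) := by
          rw [lintegral_const_mul' _ _ (by norm_num), lintegral_add_left' (hc.pow_const 2),
            lintegral_sub_left_eq_self (fun l => c l ^ 2) k]
      _ = 8 * S := by ring
  -- Here c does not depend on l: Cauchy-Schwarz bounds the convolution uniformly in k, and c
  -- supplies the decay. Together the bounds give 36 = 4 · (8 + 1).
  have h2 : ∀ k, (c k * ∫⁻ l, a (k - l) * b l) ^ 2 ≤ M * c k ^ 2 := by
    intro k
    rw [mul_pow, mul_comm]
    gcongr
    refine (lintegral_mul_sq_le (hsub k ha) hb).trans ?_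
    rw [lintegral_sub_left_eq_self (fun l => a l ^ 2) k]
  have hm : AEMeasurable fun k => M * c k ^ 2 := (hc.pow_const 2).const_mul _
  calc _ ≤ ∫⁻ k, 4 * (8 * S * (∫⁻ l, (a (k - l) * b l) ^ 2) + M * c k ^ 2) := by
        refine lintegral_mono fun k => (ennreal_add_sq_le _ _).trans ?_
        gcongr
        · exact h1 k
        · exact h2 k
    _ = 4 * ((∫⁻ k, 8 * S * ∫⁻ l, (a (k - l) * b l) ^ 2) + M * S) := by
        rw [lintegral_const_mul' _ _ (by norm_num), lintegral_add_right' _ hm,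
          lintegral_const_mul'' _ (hc.pow_const 2)]
    _ ≤ 4 * (8 * S * M + M * S) := by
        gcongr
        rw [← hconv, lintegral_const_mul'']
        have hmeas : AEMeasurable (fun p : ℝ × ℝ => (a (p.1 - p.2) * b p.2) ^ 2)
            (volume.prod volume) := by
          refine ((ha.comp_quasiMeasurePreserving ?_).mul
            (hb.comp_quasiMeasurePreserving Measure.quasiMeasurePreserving_snd)).pow_const 2
          exact quasiMeasurePreserving_sub volume volume
        exact hmeas.lintegral_prod_right'
    _ = _ := by ring

theorem lintegral_sobWeight_neg_sq_lt_top {s : ℝ} (hs : 1 / 2 < s) :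
    ∫⁻ k, ENNReal.ofReal (sobWeight (-s) k) ^ 2 < ∞ := by
  have h : Integrable fun k : ℝ => (1 + ‖k‖ ^ 2) ^ (-(2 * s) / 2) :=
    integrable_rpow_neg_one_add_norm_sq (by simp; linarith)
  refine lt_of_eq_of_lt (lintegral_congr fun k => ?_) h.lintegral_lt_top
  rw [← ENNReal.ofReal_pow (sobWeight_pos _ _).le, sobWeight_sq, Real.norm_eq_abs, sq_abs]
  congr 2
  ring

theorem eLpNorm_two_sq (f : ℝ → ℂ) : eLpNorm f 2 ^ 2 = ∫⁻ k, ‖f k‖ₑ ^ 2 := by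
  have := eLpNorm_nnreal_pow_eq_lintegral (μ := volume) (f := f) (p := 2) two_ne_zero
  simpa using this

theorem enorm_weighted (t : ℝ) (U : ℝ → ℂ) (k : ℝ) :
    ‖weighted t U k‖ₑ = ENNReal.ofReal (sobWeight t k) * ‖U k‖ₑ := by
  rw [← ofReal_norm, norm_weighted, ENNReal.ofReal_mul (sobWeight_pos t k).le, ofReal_norm]

/-- The convolution of `U` with `(1 + k²)^(t/2) U ∈ L²` and `V` with `(1 + k²)^(s/2) V ∈ L²`,
`|t| ≤ s`, `s > 1/2`, converges absolutely, and its norm is controlled by those of `U`, `V`. -/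
theorem exists_lintegral_sq_weight_conv_le {s t : ℝ} (hs : 1 / 2 < s) (hts : |t| ≤ s) :
    ∃ C : ℝ≥0∞, C ≠ ∞ ∧ ∀ U V : ℝ → ℂ, AEStronglyMeasurable U → AEStronglyMeasurable V →
      ∫⁻ k, (ENNReal.ofReal (sobWeight t k) * ∫⁻ l, ‖U (k - l) * V l‖ₑ) ^ 2 ≤
        (C * eLpNorm (weighted t U) 2 * eLpNorm (weighted s V) 2) ^ 2 := by
  set S := ∫⁻ k, ENNReal.ofReal (sobWeight (-s) k) ^ 2 with hS
  have hS' : S ≠ ∞ := (lintegral_sobWeight_neg_sq_lt_top hs).ne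
  set K := ENNReal.ofReal (4 ^ (s / 2))
  refine ⟨K * (36 * S) ^ (1 / 2 : ℝ), ?_, fun U V hU hV => ?_⟩
  · exact ENNReal.mul_ne_top ENNReal.ofReal_ne_top
      (ENNReal.rpow_ne_top_of_nonneg (by norm_num) (ENNReal.mul_ne_top (by norm_num) hS'))
  have hsq : ∀ x : ℝ≥0∞, (x ^ (1 / 2 : ℝ)) ^ 2 = x := fun x => by
    rw [← ENNReal.rpow_natCast, ← ENNReal.rpow_mul]; norm_num
  set c : ℝ → ℝ≥0∞ := fun k => ENNReal.ofReal (sobWeight (-s) k)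
  set a : ℝ → ℝ≥0∞ := fun k => ‖weighted t U k‖ₑ with ha
  set b : ℝ → ℝ≥0∞ := fun k => ‖weighted s V k‖ₑ with hb
  have hc : Measurable c := (continuous_sobWeight _).measurable.ennreal_ofReal
  have hpt : ∀ k l, ENNReal.ofReal (sobWeight t k) * ‖U (k - l) * V l‖ₑ ≤
      K * ((c l + c (k - l)) * (a (k - l) * b l) + c k * (a (k - l) * b l)) := by
    intro k l
    have h := ENNReal.ofReal_le_ofReal (sobWeight_le t s hts k l)
    have p := fun t k => (sobWeight_pos t k).le
    rw [ENNReal.ofReal_mul (by positivity), ENNReal.ofReal_mul (mul_nonneg (p _ _) (p _ _)),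
      ENNReal.ofReal_mul (p _ _), ENNReal.ofReal_add (add_nonneg (p _ _) (p _ _)) (p _ _),
      ENNReal.ofReal_add (p _ _) (p _ _)] at h
    calc _ ≤ _ := mul_le_mul_left h _
      _ = _ := by simp only [ha, hb, enorm_weighted, enorm_mul]; ring
  have hint : ∀ k, ENNReal.ofReal (sobWeight t k) * ∫⁻ l, ‖U (k - l) * V l‖ₑ ≤
      K * ((∫⁻ l, (c l + c (k - l)) * (a (k - l) * b l)) + c k * ∫⁻ l, a (k - l) * b l) := by
    intro k
    have hmeas : AEMeasurable fun l => a (k - l) * b l := by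
      refine AEMeasurable.mul ?_ (aestronglyMeasurable_weighted hV).enorm
      exact (aestronglyMeasurable_weighted (t := t) hU).enorm.comp_quasiMeasurePreserving
        (Measure.measurePreserving_sub_left volume k).quasiMeasurePreserving
    rw [← lintegral_const_mul' _ _ ENNReal.ofReal_ne_top,
      ← lintegral_const_mul' (c k) _ ENNReal.ofReal_ne_top,
      ← lintegral_add_right' _ (hmeas.const_mul _),
      ← lintegral_const_mul' _ _ ENNReal.ofReal_ne_top]
    exact lintegral_mono (hpt k)
  calc _ ≤ ∫⁻ k, K ^ 2 * ((∫⁻ l, (c l + c (k - l)) * (a (k - l) * b l)) +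
          c k * ∫⁻ l, a (k - l) * b l) ^ 2 := by
        refine lintegral_mono fun k => ?_
        rw [← mul_pow]
        exact pow_le_pow_left₀ zero_le (hint k) 2
    _ ≤ K ^ 2 * (36 * S * ((∫⁻ k, a k ^ 2) * ∫⁻ k, b k ^ 2)) := by
        rw [lintegral_const_mul' _ _ (ENNReal.pow_ne_top ENNReal.ofReal_ne_top)]
        gcongr
        exact lintegral_sq_conv_le (aestronglyMeasurable_weighted hU).enorm
          (aestronglyMeasurable_weighted hV).enorm hc.aemeasurable
    _ = _ := by
        rw [mul_pow, mul_pow, mul_pow, hsq, eLpNorm_two_sq, eLpNorm_two_sq]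
        ring

/-- The Fourier transform of the product, `(1/2π) (U ∗ V)`. -/
noncomputable def convDensity (U V : ℝ → ℂ) (k : ℝ) : ℂ :=
  (1 / (2 * Real.pi) : ℂ) * ∫ l : ℝ, U (k - l) * V l

theorem mulDist_eq (u v : 𝓢'(ℝ, ℂ)) :
    mulDist u v = ofFourierDensity (convDensity (fourierDensity u) (fourierDensity v)) := rfl

theorem aestronglyMeasurable_convDensity {U V : ℝ → ℂ} (hU : AEStronglyMeasurable U)
    (hV : AEStronglyMeasurable V) : AEStronglyMeasurable (convDensity U V) := by
  refine AEStronglyMeasurable.const_mul ?_ _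
  refine AEStronglyMeasurable.integral_prod_right' (f := fun p : ℝ × ℝ => U (p.1 - p.2) * V p.2) ?_
  exact (hU.comp_quasiMeasurePreserving (quasiMeasurePreserving_sub volume volume)).mul
    (hV.comp_quasiMeasurePreserving Measure.quasiMeasurePreserving_snd)

theorem norm_one_div_two_pi_le : ‖(1 / (2 * Real.pi) : ℂ)‖ ≤ 1 := by
  rw [norm_div, norm_one, norm_mul, Complex.norm_real, Complex.norm_ofNat,
    Real.norm_of_nonneg Real.pi_pos.le]
  exact div_le_one_of_le₀ one_le_two_pi (by positivity)

theorem exists_eLpNorm_convDensity_le {s t : ℝ} (hs : 1 / 2 < s) (hts : |t| ≤ s) :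
    ∃ C : ℝ≥0∞, C ≠ ∞ ∧ ∀ U V : ℝ → ℂ, AEStronglyMeasurable U → AEStronglyMeasurable V →
      eLpNorm (weighted t (convDensity U V)) 2 ≤
        C * eLpNorm (weighted t U) 2 * eLpNorm (weighted s V) 2 := by
  obtain ⟨C, hC, h⟩ := exists_lintegral_sq_weight_conv_le hs hts
  refine ⟨C, hC, fun U V hU hV => ?_⟩
  rw [← ENNReal.pow_le_pow_left_iff two_ne_zero, eLpNorm_two_sq]
  refine (lintegral_mono fun k => ?_).trans (h U V hU hV)
  rw [enorm_weighted]
  gcongr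
  rw [convDensity, enorm_mul]
  calc _ ≤ 1 * ‖∫ l : ℝ, U (k - l) * V l‖ₑ := by
        gcongr
        rw [← ofReal_norm, ← ENNReal.ofReal_one]
        exact ENNReal.ofReal_le_ofReal norm_one_div_two_pi_le
    _ ≤ _ := by rw [one_mul]; exact enorm_integral_le_lintegral_enorm _

/-- The convolution converges absolutely almost everywhere. -/
theorem ae_integrable_conv {s t : ℝ} (hs : 1 / 2 < s) (hts : |t| ≤ s) {U V : ℝ → ℂ}
    (hU : MemLp (weighted t U) 2) (hV : MemLp (weighted s V) 2) :
    ∀ᵐ k, Integrable fun l => U (k - l) * V l := by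
  obtain ⟨C, hC, h⟩ := exists_lintegral_sq_weight_conv_le hs hts
  have hU1 := aestronglyMeasurable_of_memLp_weighted hU
  have hV1 := aestronglyMeasurable_of_memLp_weighted hV
  have hlt := (h U V hU1 hV1).trans_lt (ENNReal.pow_lt_top (ENNReal.mul_lt_top
    (ENNReal.mul_lt_top hC.lt_top hU.2) hV.2))
  have hmeas : AEStronglyMeasurable (fun p : ℝ × ℝ => U (p.1 - p.2) * V p.2)
      (volume.prod volume) :=
    (hU1.comp_quasiMeasurePreserving (quasiMeasurePreserving_sub volume volume)).mul
      (hV1.comp_quasiMeasurePreserving Measure.quasiMeasurePreserving_snd)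
  have hm : AEMeasurable fun k =>
      (ENNReal.ofReal (sobWeight t k) * ∫⁻ l, ‖U (k - l) * V l‖ₑ) ^ 2 :=
    ((continuous_sobWeight t).measurable.ennreal_ofReal.aemeasurable.mul
      hmeas.enorm.lintegral_prod_right').pow_const 2
  filter_upwards [ae_lt_top' hm hlt.ne, hmeas.prodMk_left] with k hk hk2
  refine ⟨hk2, ?_⟩
  -- The weight is strictly positive, so an infinite inner integral would make the outer integrand
  -- infinite at k.
  by_contra hinf
  rw [HasFiniteIntegral, not_lt, top_le_iff] at hinf
  rw [hinf, ENNReal.mul_top (by simpa using sobWeight_pos t k)] at hk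
  simp at hk

/-- Equality holds at every k, since reflections and translates of null sets are null. The
representative chosen by `fourierDensity` therefore does not matter. -/
theorem convDensity_congr {U U' V V' : ℝ → ℂ} (hU : U =ᵐ[volume] U') (hV : V =ᵐ[volume] V') :
    convDensity U V = convDensity U' V' := by
  ext k
  rw [convDensity, convDensity]
  congr 1
  refine integral_congr_ae ?_
  have := (Measure.measurePreserving_sub_left volume k).quasiMeasurePreserving.ae hU
  filter_upwards [this, hV] with l h1 h2
  rw [h1, h2]

/-- The substitution l ↦ k - l is valid for Bochner integrals whether or not they converge. -/
theorem convDensity_comm (U V : ℝ → ℂ) : convDensity U V = convDensity V U := by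
  ext k
  rw [convDensity, convDensity, ← integral_sub_left_eq_self _ volume k]
  simp [mul_comm]

theorem convDensity_sub_left {s t : ℝ} (hs : 1 / 2 < s) (hts : |t| ≤ s) {U U' V : ℝ → ℂ}
    (hU : MemLp (weighted t U) 2) (hU' : MemLp (weighted t U') 2)
    (hV : MemLp (weighted s V) 2) :
    convDensity (U - U') V =ᵐ[volume] convDensity U V - convDensity U' V := by
  filter_upwards [ae_integrable_conv hs hts hU hV, ae_integrable_conv hs hts hU' hV] with k h1 h2
  simp only [convDensity, Pi.sub_apply, sub_mul]
  rw [integral_sub h1 h2, mul_sub]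

theorem mulDist_comm (u v : 𝓢'(ℝ, ℂ)) : mulDist u v = mulDist v u := by
  rw [mulDist_eq, mulDist_eq, convDensity_comm]

/-- The product of `u ∈ H^t` and `v ∈ H^s` is in `H^t`, if `s > 1/2` and `|t| ≤ s`. -/
theorem mulDist_spec {s t : ℝ} (hs : 1 / 2 < s) (hts : |t| ≤ s) {u v : 𝓢'(ℝ, ℂ)}
    (hu : MemSobolev t 2 u) (hv : MemSobolev s 2 v) :
    HasFourierDensity (mulDist u v) (convDensity (fourierDensity u) (fourierDensity v)) ∧
      MemSobolev t 2 (mulDist u v) := by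
  obtain ⟨C, hC, h⟩ := exists_eLpNorm_convDensity_le hs hts
  have hU := MemSobolev.memLp_weighted hu
  have hV := MemSobolev.memLp_weighted hv
  have hU1 := aestronglyMeasurable_of_memLp_weighted hU
  have hV1 := aestronglyMeasurable_of_memLp_weighted hV
  refine hasFourierDensity_ofFourierDensity
    ⟨aestronglyMeasurable_weighted (aestronglyMeasurable_convDensity hU1 hV1), ?_⟩
  exact (h _ _ hU1 hV1).trans_lt (ENNReal.mul_lt_top (ENNReal.mul_lt_top hC.lt_top hU.2) hV.2)

theorem exists_sobolevNorm_mulDist_le {s t : ℝ} (hs : 1 / 2 < s) (hts : |t| ≤ s) :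
    ∃ C : ℝ, 0 ≤ C ∧ ∀ u v : 𝓢'(ℝ, ℂ), MemSobolev t 2 u → MemSobolev s 2 v →
      sobolevNorm t (mulDist u v) ≤ C * sobolevNorm t u * sobolevNorm s v := by
  obtain ⟨C, hC, h⟩ := exists_eLpNorm_convDensity_le hs hts
  -- The normalisation √(1/2π) occurs once on the left of the estimate and twice on the right.
  refine ⟨C.toReal * (Real.sqrt (1 / (2 * Real.pi)))⁻¹, by positivity, fun u v hu hv => ?_⟩
  have hU := MemSobolev.memLp_weighted hu
  have hV := MemSobolev.memLp_weighted hv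
  obtain ⟨h1, h2⟩ := mulDist_spec hs hts hu hv
  have h3 := h _ _ (aestronglyMeasurable_of_memLp_weighted hU)
    (aestronglyMeasurable_of_memLp_weighted hV)
  have h4 := ENNReal.toReal_mono (ENNReal.mul_ne_top (ENNReal.mul_ne_top hC hU.2.ne) hV.2.ne) h3
  rw [ENNReal.toReal_mul, ENNReal.toReal_mul] at h4
  rw [sobolevNorm_eq h1 ((memSobolev_iff_of_hasFourierDensity h1).1 h2),
    sobolevNorm_eq (MemSobolev.hasFourierDensity hu) hU,
    sobolevNorm_eq (MemSobolev.hasFourierDensity hv) hV]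
  have hpos : 0 < Real.sqrt (1 / (2 * Real.pi)) := Real.sqrt_pos.2 (by positivity)
  calc _ ≤ _ := mul_le_mul_of_nonneg_left h4 hpos.le
    _ = _ := by field_simp

theorem mulDist_sub_left {s t : ℝ} (hs : 1 / 2 < s) (hts : |t| ≤ s) {u u' v : 𝓢'(ℝ, ℂ)}
    (hu : MemSobolev t 2 u) (hu' : MemSobolev t 2 u') (hv : MemSobolev s 2 v) :
    mulDist (u - u') v = mulDist u v - mulDist u' v := by
  have h := (mulDist_spec hs hts (hu.sub hu') hv).1
  have h1 := (mulDist_spec hs hts hu hv).1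
  have h2 := (mulDist_spec hs hts hu' hv).1
  refine h.unique ((h1.sub h2).congr ?_)
  rw [convDensity_congr ((MemSobolev.hasFourierDensity hu).sub
    (MemSobolev.hasFourierDensity hu')).fourierDensity_ae (ae_eq_refl _)]
  exact (convDensity_sub_left hs hts (MemSobolev.memLp_weighted hu)
    (MemSobolev.memLp_weighted hu') (MemSobolev.memLp_weighted hv)).symm

/-! ### Fractional derivatives -/

theorem norm_fracSymbol (α k : ℝ) : ‖fracSymbol α k‖ = |k| ^ α := by
  rw [fracSymbol, Complex.norm_cpow_real, norm_mul, Complex.norm_I, one_mul, Complex.norm_real,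
    Real.norm_eq_abs]

theorem norm_fracSymbol_le {α : ℝ} (hα : 0 ≤ α) (k : ℝ) : ‖fracSymbol α k‖ ≤ sobWeight α k := by
  rw [norm_fracSymbol, sobWeight, ← sq_abs k]
  calc |k| ^ α = (|k| ^ 2) ^ (α / 2) := by
        rw [← Real.rpow_natCast, ← Real.rpow_mul (abs_nonneg k)]
        congr 1
        push_cast
        ring
    _ ≤ _ := Real.rpow_le_rpow (by positivity) (by linarith) (by linarith)

theorem measurable_fracSymbol (α : ℝ) : Measurable (fracSymbol α) := by
  unfold fracSymbol
  fun_prop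

theorem fracSymbol_one (k : ℝ) : fracSymbol 1 k = Complex.I * k := by
  simp [fracSymbol]

theorem tendsto_fracSymbol (k : ℝ) :
    Tendsto (fun α : ℝ => fracSymbol α k) (𝓝 1) (𝓝 (fracSymbol 1 k)) := by
  have h : ContinuousAt (fun z : ℂ => (Complex.I * (k : ℂ)) ^ z) ((1 : ℝ) : ℂ) :=
    -- Continuity in the exponent near 1 ≠ 0 also covers the base 0, that is k = 0.
    continuousAt_const_cpow' (by simp)
  exact h.tendsto.comp (Complex.continuous_ofReal.tendsto 1)

theorem norm_weighted_fracSymbol_le {s α : ℝ} (hα : 0 ≤ α) (U : ℝ → ℂ) (k : ℝ) :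
    ‖weighted (s - α) (fun k => fracSymbol α k * U k) k‖ ≤ ‖weighted s U k‖ := by
  have e : sobWeight s k = sobWeight (s - α) k * sobWeight α k := by
    rw [← sobWeight_add]; ring_nf
  rw [norm_weighted, norm_weighted, norm_mul, ← mul_assoc, e]
  have := (sobWeight_pos (s - α) k).le
  gcongr
  exact norm_fracSymbol_le hα k

theorem memLp_weighted_fracSymbol {s α : ℝ} (hα : 0 ≤ α) {U : ℝ → ℂ}
    (hU : MemLp (weighted s U) 2) :
    MemLp (weighted (s - α) fun k => fracSymbol α k * U k) 2 :=
  hU.of_le (aestronglyMeasurable_weighted ((measurable_fracSymbol α).aestronglyMeasurable.mul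
    (aestronglyMeasurable_of_memLp_weighted hU)))
    (Eventually.of_forall (norm_weighted_fracSymbol_le hα U))

/-- The fractional derivative of order `α` maps `H^s` to `H^(s - α)`. -/
theorem fracDerivDist_spec {s α : ℝ} (hα : 0 ≤ α) {u : 𝓢'(ℝ, ℂ)} (hu : MemSobolev s 2 u) :
    HasFourierDensity (fracDerivDist α u) (fun k => fracSymbol α k * fourierDensity u k) ∧
      MemSobolev (s - α) 2 (fracDerivDist α u) :=
  hasFourierDensity_ofFourierDensity (memLp_weighted_fracSymbol hα (MemSobolev.memLp_weighted hu))

theorem sobolevNorm_fracDerivDist_le {s α : ℝ} (hα : 0 ≤ α) {u : 𝓢'(ℝ, ℂ)}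
    (hu : MemSobolev s 2 u) : sobolevNorm (s - α) (fracDerivDist α u) ≤ sobolevNorm s u := by
  have hU := MemSobolev.memLp_weighted hu
  rw [sobolevNorm_eq (fracDerivDist_spec hα hu).1 (memLp_weighted_fracSymbol hα hU),
    sobolevNorm_eq (MemSobolev.hasFourierDensity hu) hU]
  gcongr
  · exact hU.2.ne
  · exact eLpNorm_mono (norm_weighted_fracSymbol_le hα _)

/-- The distributional derivative is the fractional derivative of order one. -/
theorem derivCLM_eq_fracDerivDist {s : ℝ} {u : 𝓢'(ℝ, ℂ)} (hu : MemSobolev s 2 u) :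
    derivCLM ℂ u = fracDerivDist 1 u := by
  have hU := MemSobolev.hasFourierDensity hu
  have hg : (fun x : ℝ => 2 * Real.pi * Complex.I * (x : ℂ)).HasTemperateGrowth := by fun_prop
  have h : HasFourierDensity (derivCLM ℂ u) (fun k => fracSymbol 1 k * fourierDensity u k) := by
    intro φ
    set ψ : 𝓢(ℝ, ℂ) :=
      SchwartzMap.smulLeftCLM ℂ (fun x : ℝ => 2 * Real.pi * Complex.I * (x : ℂ)) φ with hψ
    have e : ∀ x : ℝ, φ x * (fracSymbol 1 (2 * Real.pi * x) * fourierDensity u (2 * Real.pi * x)) =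
        ψ x * fourierDensity u (2 * Real.pi * x) := by
      intro x
      rw [hψ, SchwartzMap.smulLeftCLM_apply_apply hg, fracSymbol_one, smul_eq_mul]
      push_cast
      ring
    have e2 : 𝓕 (derivCLM ℂ u) φ = 𝓕 u ψ := by
      -- Differentiating 𝓕 φ under the integral brings down -2πix, and 2πix is the symbol ik at k =
      -- 2πx.
      have h3 : -SchwartzMap.derivCLM ℂ ℂ (𝓕 φ) = 𝓕 ψ := by
        ext x
        have h4 : Integrable fun x : ℝ => x • φ x := by
          have h5 := (SchwartzMap.smulLeftCLM ℂ (fun x : ℝ => (x : ℂ)) φ).integrable (μ := volume)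
          refine h5.congr (Eventually.of_forall fun x => ?_)
          rw [SchwartzMap.smulLeftCLM_apply_apply (by fun_prop)]
          simp
        have h6 := congrFun (Real.deriv_fourier φ.integrable h4) x
        rw [neg_apply, SchwartzMap.derivCLM_apply, SchwartzMap.fourier_coe, h6,
          SchwartzMap.fourier_coe, Real.fourier_real_eq, Real.fourier_real_eq, ← integral_neg]
        refine integral_congr_ae (Eventually.of_forall fun y => ?_)
        simp only [hψ, SchwartzMap.smulLeftCLM_apply_apply hg]
        rw [← smul_neg]
        congr 1
        simp
      rw [TemperedDistribution.fourier_apply, TemperedDistribution.fourier_apply,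
        derivCLM_apply_apply, h3]
    simp only [e]
    exact ⟨(hU ψ).1, e2.trans (hU ψ).2⟩
  exact h.unique (fracDerivDist_spec zero_le_one hu).1

/-- The symbols converge pointwise in k, and for 0 < α < 1 their difference is at most 2(1 +
k²)^(1/2), so 4(1 + k²)^s |U|² dominates. -/
theorem tendsto_sobolevNorm_fracDerivDist_sub {s : ℝ} {u : 𝓢'(ℝ, ℂ)} (hu : MemSobolev s 2 u) :
    Tendsto (fun α : ℝ => sobolevNorm (s - 1) (fracDerivDist α u - fracDerivDist 1 u))
      (𝓝[<] 1) (𝓝 0) := by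
  set U := fourierDensity u with hUdef
  have hU : MemLp (weighted s U) 2 := MemSobolev.memLp_weighted hu
  have hU1 := aestronglyMeasurable_of_memLp_weighted hU
  have hI : Integrable fun k => 4 * ‖weighted s U k‖ ^ 2 :=
    ((memLp_two_iff_integrable_sq_norm hU.1).1 hU).const_mul 4
  have hev : ∀ᶠ α : ℝ in 𝓝[<] 1, α ∈ Set.Ioo (0 : ℝ) 1 := Ioo_mem_nhdsLT zero_lt_one
  have hlim : Tendsto (fun α : ℝ => ∫ k : ℝ, (1 + k ^ 2) ^ (s - 1) *
      ‖(fracSymbol α k - fracSymbol 1 k) * U k‖ ^ 2) (𝓝[<] 1) (𝓝 (∫ _ : ℝ, (0 : ℝ))) := by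
    refine tendsto_integral_filter_of_dominated_convergence _ ?_ ?_ hI ?_
    · refine Eventually.of_forall fun α => ?_
      have h1 : Measurable fun k : ℝ => (1 + k ^ 2) ^ (s - 1) := by fun_prop
      exact h1.aestronglyMeasurable.mul ((((measurable_fracSymbol α).sub
        (measurable_fracSymbol 1)).aestronglyMeasurable.mul hU1).norm.pow 2)
    · filter_upwards [hev] with α hα
      refine Eventually.of_forall fun k => ?_
      have h1 : ‖fracSymbol α k - fracSymbol 1 k‖ ≤ 2 * sobWeight 1 k := by
        have h2 := norm_fracSymbol_le hα.1.le k
        have h3 := norm_fracSymbol_le zero_le_one k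
        have h4 := sobWeight_mono hα.2.le k
        have h5 := norm_sub_le (fracSymbol α k) (fracSymbol 1 k)
        linarith
      rw [← sobWeight_sq, ← mul_pow, Real.norm_of_nonneg (by positivity), norm_weighted]
      have e : sobWeight s k = sobWeight (s - 1) k * sobWeight 1 k := by
        rw [← sobWeight_add]; ring_nf
      have hp := (sobWeight_pos (s - 1) k).le
      calc _ ≤ (sobWeight (s - 1) k * ((2 * sobWeight 1 k) * ‖U k‖)) ^ 2 := by
            rw [norm_mul]
            gcongr
        _ = _ := by rw [e]; ring
    · refine Eventually.of_forall fun k => ?_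
      have h1 : Tendsto (fun α : ℝ => (1 + k ^ 2) ^ (s - 1) *
          ‖(fracSymbol α k - fracSymbol 1 k) * U k‖ ^ 2) (𝓝 1) (𝓝 ((1 + k ^ 2) ^ (s - 1) *
          ‖(fracSymbol 1 k - fracSymbol 1 k) * U k‖ ^ 2)) :=
        ((((tendsto_fracSymbol k).sub_const _).mul_const _).norm.pow 2).const_mul _
      simpa using h1.mono_left nhdsWithin_le_nhds
  have h2 : Tendsto (fun α : ℝ => Real.sqrt (1 / (2 * Real.pi) * ∫ k : ℝ, (1 + k ^ 2) ^ (s - 1) *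
      ‖(fracSymbol α k - fracSymbol 1 k) * U k‖ ^ 2)) (𝓝[<] 1) (𝓝 0) := by
    have := (Real.continuous_sqrt.tendsto _).comp (hlim.const_mul (1 / (2 * Real.pi)))
    rw [integral_zero, mul_zero, Real.sqrt_zero] at this
    exact this
  refine h2.congr' ?_
  filter_upwards [hev] with α hα
  rw [sobolevNorm]
  congr 2
  have hd := ((fracDerivDist_spec hα.1.le hu).1.sub
    (fracDerivDist_spec zero_le_one hu).1).fourierDensity_ae
  refine integral_congr_ae ?_
  filter_upwards [hd] with k hk
  rw [hk]
  simp [sub_mul, hUdef]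

/-! ### The Hirota operator on Sobolev spaces -/

theorem hirotaDist_swap (α : ℝ) (f g : 𝓢'(ℝ, ℂ)) : hirotaDist α f g = -hirotaDist α g f := by
  rw [hirotaDist, hirotaDist, mulDist_comm (fracDerivDist α g) f,
    mulDist_comm g (fracDerivDist α f), neg_sub]

theorem hirotaDist_self (α : ℝ) (f : 𝓢'(ℝ, ℂ)) : hirotaDist α f f = 0 := by
  rw [hirotaDist, mulDist_comm f, sub_self]

theorem abs_sub_le_of_half_lt {s α : ℝ} (hs : 1 / 2 < s) (hα : 0 ≤ α) (hα1 : α ≤ 1) :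
    |s - α| ≤ s := by
  rw [abs_le]; constructor <;> linarith

theorem memSobolev_hirotaDist {s α : ℝ} (hs : 1 / 2 < s) (hα : 0 ≤ α) (hα1 : α ≤ 1)
    {f g : 𝓢'(ℝ, ℂ)} (hf : MemSobolev s 2 f) (hg : MemSobolev s 2 g) :
    MemSobolev (s - α) 2 (hirotaDist α f g) := by
  have hts := abs_sub_le_of_half_lt hs hα hα1
  -- Commuting puts the differentiated, less regular factor first, as `mulDist_spec` requires.
  rw [hirotaDist, mulDist_comm f]
  exact (mulDist_spec hs hts (fracDerivDist_spec hα hf).2 hg).2.sub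
    (mulDist_spec hs hts (fracDerivDist_spec hα hg).2 hf).2

theorem exists_sobolevNorm_hirotaDist_le {s α : ℝ} (hs : 1 / 2 < s) (hα : 0 ≤ α) (hα1 : α ≤ 1) :
    ∃ C : ℝ, ∀ f g : 𝓢'(ℝ, ℂ), MemSobolev s 2 f → MemSobolev s 2 g →
      sobolevNorm (s - α) (hirotaDist α f g) ≤ C * sobolevNorm s f * sobolevNorm s g := by
  have hts := abs_sub_le_of_half_lt hs hα hα1
  obtain ⟨C, hC0, hC⟩ := exists_sobolevNorm_mulDist_le hs hts
  refine ⟨2 * C, fun f g hf hg => ?_⟩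
  have hDf := (fracDerivDist_spec hα hf).2
  have hDg := (fracDerivDist_spec hα hg).2
  have h1 : sobolevNorm (s - α) (mulDist (fracDerivDist α f) g) ≤
      C * sobolevNorm s f * sobolevNorm s g := by
    refine (hC _ _ hDf hg).trans ?_
    have := sobolevNorm_nonneg s g
    gcongr
    exact sobolevNorm_fracDerivDist_le hα hf
  have h2 : sobolevNorm (s - α) (mulDist (fracDerivDist α g) f) ≤
      C * sobolevNorm s g * sobolevNorm s f := by
    refine (hC _ _ hDg hf).trans ?_
    have := sobolevNorm_nonneg s f
    gcongr
    exact sobolevNorm_fracDerivDist_le hα hg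
  rw [hirotaDist, mulDist_comm f]
  refine (sobolevNorm_sub_le (mulDist_spec hs hts hDf hg).2 (mulDist_spec hs hts hDg hf).2).trans ?_
  linarith

theorem classicalHirota_eq {s : ℝ} {f g : 𝓢'(ℝ, ℂ)} (hf : MemSobolev s 2 f)
    (hg : MemSobolev s 2 g) : classicalHirota f g = hirotaDist 1 f g := by
  rw [classicalHirota, hirotaDist, derivCLM_eq_fracDerivDist hf, derivCLM_eq_fracDerivDist hg]

/-- Working at order s - 1 throughout gives one product constant for all α; the constant of
`exists_sobolevNorm_hirotaDist_le` may vary with α. -/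
theorem tendsto_sobolevNorm_hirotaDist_sub {s : ℝ} (hs : 1 / 2 < s) {f g : 𝓢'(ℝ, ℂ)}
    (hf : MemSobolev s 2 f) (hg : MemSobolev s 2 g) :
    Tendsto (fun α : ℝ => sobolevNorm (s - 1) (hirotaDist α f g - classicalHirota f g))
      (𝓝[<] 1) (𝓝 0) := by
  have hts := abs_sub_le_of_half_lt hs zero_le_one le_rfl
  obtain ⟨C, hC0, hC⟩ := exists_sobolevNorm_mulDist_le hs hts
  have hlim := ((tendsto_sobolevNorm_fracDerivDist_sub hf).mul_const
    (sobolevNorm s g)).add ((tendsto_sobolevNorm_fracDerivDist_sub hg).mul_const (sobolevNorm s f))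
  have hlim' := hlim.const_mul C
  simp only [zero_mul, add_zero, mul_zero] at hlim'
  refine squeeze_zero' (Eventually.of_forall fun _ => sobolevNorm_nonneg _ _) ?_ hlim'
  have hev : ∀ᶠ α : ℝ in 𝓝[<] 1, α ∈ Set.Ioo (0 : ℝ) 1 := Ioo_mem_nhdsLT zero_lt_one
  filter_upwards [hev] with α hα
  have hD : ∀ {u : 𝓢'(ℝ, ℂ)}, MemSobolev s 2 u → MemSobolev (s - 1) 2 (fracDerivDist α u) :=
    fun hu => (fracDerivDist_spec hα.1.le hu).2.mono (by linarith [hα.2])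
  have hD1 : ∀ {u : 𝓢'(ℝ, ℂ)}, MemSobolev s 2 u → MemSobolev (s - 1) 2 (fracDerivDist 1 u) :=
    fun hu => (fracDerivDist_spec zero_le_one hu).2
  have e : hirotaDist α f g - classicalHirota f g =
      mulDist (fracDerivDist α f - fracDerivDist 1 f) g -
        mulDist (fracDerivDist α g - fracDerivDist 1 g) f := by
    rw [classicalHirota_eq hf hg, hirotaDist, hirotaDist, mulDist_comm f, mulDist_comm f,
      mulDist_sub_left hs hts (hD hf) (hD1 hf) hg, mulDist_sub_left hs hts (hD hg) (hD1 hg) hf]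
    abel
  have hf' := (hD hf).sub (hD1 hf)
  have hg' := (hD hg).sub (hD1 hg)
  rw [e]
  refine (sobolevNorm_sub_le (mulDist_spec hs hts hf' hg).2 (mulDist_spec hs hts hg' hf).2).trans ?_
  have h1 := hC _ _ hf' hg
  have h2 := hC _ _ hg' hf
  linarith

/-! ### The Hirota operator on Schwartz functions -/

theorem angularFourier_two_pi_mul (f : 𝓢(ℝ, ℂ)) (x : ℝ) :
    angularFourier f (2 * Real.pi * x) = 𝓕 (f : ℝ → ℂ) x := by
  rw [Real.fourier_real_eq_integral_exp_smul, angularFourier]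
  refine integral_congr_ae (Eventually.of_forall fun ξ => ?_)
  simp only [smul_eq_mul]
  rw [mul_comm]
  congr 2
  push_cast
  ring

theorem angularFourier_eq (f : 𝓢(ℝ, ℂ)) (k : ℝ) :
    angularFourier f k = (𝓕 f : 𝓢(ℝ, ℂ)) ((2 * Real.pi)⁻¹ * k) := by
  rw [SchwartzMap.fourier_coe, ← angularFourier_two_pi_mul, mul_inv_cancel_left₀ two_pi_ne_zero]

theorem memLp_weighted_angularFourier (s : ℝ) (f : 𝓢(ℝ, ℂ)) :
    MemLp (weighted s (angularFourier f)) 2 :=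
  (memSobolev_iff_of_hasFourierDensity (hasFourierDensity_schwartz f)).1 f.memSobolev

/-- Cauchy-Schwarz against the weight of order -s, which is in L² for s > 1/2. -/
theorem integrable_of_memLp_weighted {s : ℝ} (hs : 1 / 2 < s) {U : ℝ → ℂ}
    (hU : MemLp (weighted s U) 2) : Integrable U := by
  have h1 : AEStronglyMeasurable (weighted (-s) fun _ => 1) :=
    aestronglyMeasurable_weighted aestronglyMeasurable_const
  have h2 : MemLp (weighted (-s) fun _ => 1) 2 := by
    refine ⟨h1, ?_⟩
    have h3 := lintegral_sobWeight_neg_sq_lt_top hs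
    refine (ENNReal.pow_lt_top_iff.1 (?_ : _ ^ 2 < _)).resolve_right two_ne_zero
    rw [eLpNorm_two_sq]
    simpa [enorm_weighted] using h3
  refine (h2.integrable_mul hU).congr (Eventually.of_forall fun k => ?_)
  have : (sobWeight s k : ℂ) ≠ 0 := by exact_mod_cast (sobWeight_pos s k).ne'
  simp [weighted, sobWeight_neg, this]

theorem integrable_angularFourier (f : 𝓢(ℝ, ℂ)) : Integrable (angularFourier f) :=
  integrable_of_memLp_weighted (s := 1) (by norm_num) (memLp_weighted_angularFourier 1 f)

theorem integrable_fracSymbol_mul_angularFourier {α : ℝ} (hα : 0 ≤ α) (f : 𝓢(ℝ, ℂ)) :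
    Integrable fun k => fracSymbol α k * angularFourier f k := by
  refine integrable_of_memLp_weighted (s := α + 1 - α) (by linarith) ?_
  exact memLp_weighted_fracSymbol hα (memLp_weighted_angularFourier (α + 1) f)

/-- The function with Fourier transform `U`. -/
noncomputable def angularFourierInv (U : ℝ → ℂ) : ℝ → ℂ := 𝓕⁻ fun x => U (2 * Real.pi * x)

theorem angularFourierInv_eq (U : ℝ → ℂ) (ξ : ℝ) : angularFourierInv U ξ =
    (1 / (2 * Real.pi) : ℂ) * ∫ k : ℝ, U k * Complex.exp (Complex.I * k * ξ) := by
  have h := Measure.integral_comp_mul_left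
    (fun k : ℝ => U k * Complex.exp (Complex.I * k * ξ)) (2 * Real.pi)
  rw [angularFourierInv, Real.fourierInv_eq']
  rw [abs_of_pos (by positivity), Complex.real_smul] at h
  have e : (1 / (2 * Real.pi) : ℂ) = (((2 * Real.pi)⁻¹ : ℝ) : ℂ) := by push_cast; ring
  rw [e, ← h]
  refine integral_congr_ae (Eventually.of_forall fun x => ?_)
  simp only [smul_eq_mul]
  rw [mul_comm]
  congr 2
  simp
  ring

theorem fracDeriv_eq (α : ℝ) (f : 𝓢(ℝ, ℂ)) :
    fracDeriv α f = angularFourierInv fun k => fracSymbol α k * angularFourier f k := by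
  ext ξ
  rw [angularFourierInv_eq, fracDeriv]

theorem angularFourierInv_angularFourier (f : 𝓢(ℝ, ℂ)) :
    angularFourierInv (angularFourier f) = f := by
  rw [angularFourierInv]
  simp only [angularFourier_two_pi_mul]
  rw [← SchwartzMap.fourier_coe, ← SchwartzMap.fourierInv_coe]
  simp

theorem angularFourierInv_eq_fourier (U : ℝ → ℂ) :
    angularFourierInv U = 𝓕 fun x => U (-(2 * Real.pi * x)) := by
  rw [angularFourierInv, Real.fourierInv_eq_fourier_comp_neg]
  simp

theorem integrable_comp_neg_two_pi_mul {U : ℝ → ℂ} (hU : Integrable U) :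
    Integrable fun x => U (-(2 * Real.pi * x)) := by
  have := hU.comp_mul_left' (neg_ne_zero.2 two_pi_ne_zero)
  simpa using this

theorem continuous_angularFourierInv {U : ℝ → ℂ} (hU : Integrable U) :
    Continuous (angularFourierInv U) := by
  rw [angularFourierInv_eq_fourier]
  exact VectorFourier.fourierIntegral_continuous Real.continuous_fourierChar
    (by exact continuous_inner) (integrable_comp_neg_two_pi_mul hU)

theorem norm_angularFourierInv_le (U : ℝ → ℂ) (ξ : ℝ) :
    ‖angularFourierInv U ξ‖ ≤ ∫ x, ‖U (-(2 * Real.pi * x))‖ := by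
  rw [angularFourierInv_eq_fourier]
  exact VectorFourier.norm_fourierIntegral_le_integral_norm _ _ _ _ _

/-- A distribution with integrable Fourier transform is a function. -/
theorem HasFourierDensity.eq_integral {u : 𝓢'(ℝ, ℂ)} {U : ℝ → ℂ} (h : HasFourierDensity u U)
    (hU : Integrable U) (φ : 𝓢(ℝ, ℂ)) :
    Integrable (fun ξ => φ ξ * angularFourierInv U ξ) ∧
      u φ = ∫ ξ, φ ξ * angularFourierInv U ξ := by
  constructor
  · exact φ.integrable.mul_bdd (continuous_angularFourierInv hU).aestronglyMeasurable
      (Eventually.of_forall (norm_angularFourierInv_le U))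
  -- Fourier inversion followed by the multiplication formula ∫ φ̂ W = ∫ φ Ŵ, with W the reflected,
  -- rescaled density.
  · have e : u φ = 𝓕 u (𝓕⁻ φ) := by
      rw [TemperedDistribution.fourier_apply]; simp
    have h2 : ∫ ξ, 𝓕 (φ : ℝ → ℂ) ξ • U (-(2 * Real.pi * ξ)) =
        ∫ x, φ x • 𝓕 (fun x => U (-(2 * Real.pi * x))) x := by
      simpa using! VectorFourier.integral_fourierIntegral_smul_eq_flip (L := innerₗ ℝ)
        Real.continuous_fourierChar continuous_inner φ.integrable
        (integrable_comp_neg_two_pi_mul hU)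
    rw [e, (h _).2, angularFourierInv_eq_fourier]
    simp only [smul_eq_mul] at h2
    rw [← h2, ← integral_neg_eq_self]
    refine integral_congr_ae (Eventually.of_forall fun x => ?_)
    simp only [SchwartzMap.fourierInv_coe, Real.fourierInv_eq_fourier_neg]
    simp

/-- The substitution l = 2πy absorbs the factor 1/2π, leaving the plain convolution to which the
convolution theorem for `𝓕` applies. -/
theorem convDensity_two_pi_mul (U V : ℝ → ℂ) (x : ℝ) : convDensity U V (2 * Real.pi * x) =
    ∫ y, U (2 * Real.pi * (x - y)) * V (2 * Real.pi * y) := by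
  have h := Measure.integral_comp_mul_left
    (fun l : ℝ => U (2 * Real.pi * x - l) * V l) (2 * Real.pi)
  rw [abs_of_pos (by positivity), Complex.real_smul] at h
  have e : (1 / (2 * Real.pi) : ℂ) = (((2 * Real.pi)⁻¹ : ℝ) : ℂ) := by push_cast; ring
  rw [convDensity, e, ← h]
  simp only [mul_sub]

theorem integrable_convDensity {U V : ℝ → ℂ} (hU : Integrable U) (hV : Integrable V) :
    Integrable (convDensity U V) := by
  refine Integrable.const_mul ?_ _
  have := (hV.convolution_integrand (ContinuousLinearMap.mul ℂ ℂ) hU).integral_prod_left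
  refine this.congr (Eventually.of_forall fun k => ?_)
  simp [mul_comm]

theorem angularFourierInv_convDensity {U V : ℝ → ℂ} (hU : Integrable U) (hV : Integrable V)
    (ξ : ℝ) : angularFourierInv (convDensity U V) ξ =
      angularFourierInv U ξ * angularFourierInv V ξ := by
  have hU' := hU.comp_mul_left' two_pi_ne_zero
  have hV' := hV.comp_mul_left' two_pi_ne_zero
  have h := Real.fourier_mul_convolution_eq hV' hU' (-ξ)
  simp only [angularFourierInv, Real.fourierInv_eq_fourier_neg]
  refine Eq.trans ?_ (h.trans (mul_comm _ _))
  refine congrArg (fun F : ℝ → ℂ => 𝓕 F (-ξ)) (funext fun x => ?_)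
  rw [convDensity_two_pi_mul, convolution_def]
  simp [mul_comm]

theorem mulDist_apply_of_integrable {u v : 𝓢'(ℝ, ℂ)} {U V : ℝ → ℂ} (hu : HasFourierDensity u U)
    (hv : HasFourierDensity v V) (hU : Integrable U) (hV : Integrable V)
    (h : HasFourierDensity (mulDist u v) (convDensity (fourierDensity u) (fourierDensity v)))
    (φ : 𝓢(ℝ, ℂ)) :
    Integrable (fun ξ => φ ξ * (angularFourierInv U ξ * angularFourierInv V ξ)) ∧
      mulDist u v φ = ∫ ξ, φ ξ * (angularFourierInv U ξ * angularFourierInv V ξ) := by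
  rw [convDensity_congr hu.fourierDensity_ae hv.fourierDensity_ae] at h
  simp only [← angularFourierInv_convDensity hU hV]
  exact h.eq_integral (integrable_convDensity hU hV) φ

/-- The product of the fractional derivative of a Schwartz function and a Schwartz function is
the pointwise product. -/
theorem mulDist_fracDerivDist_schwartz {α : ℝ} (hα : 0 ≤ α) (f g φ : 𝓢(ℝ, ℂ)) :
    Integrable (fun ξ => φ ξ * (fracDeriv α f ξ * g ξ)) ∧
      mulDist (fracDerivDist α (f : 𝓢'(ℝ, ℂ))) (g : 𝓢'(ℝ, ℂ)) φ =
        ∫ ξ, φ ξ * (fracDeriv α f ξ * g ξ) := by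
  have hf : MemSobolev (α + 1) 2 (f : 𝓢'(ℝ, ℂ)) := f.memSobolev
  have hg : MemSobolev (α + 1) 2 (g : 𝓢'(ℝ, ℂ)) := g.memSobolev
  have hD := fracDerivDist_spec hα hf
  -- Schwartz functions lie in every H^s; order α + 1 leaves D^α f in H^1, and |1| ≤ α + 1.
  have h := (mulDist_spec (s := α + 1) (by linarith)
    (by rw [abs_of_nonneg] <;> linarith) hD.2 hg).1
  have hF : HasFourierDensity (fracDerivDist α (f : 𝓢'(ℝ, ℂ)))
      (fun k => fracSymbol α k * angularFourier f k) := by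
    refine hD.1.congr ?_
    filter_upwards [(hasFourierDensity_schwartz f).fourierDensity_ae] with k hk
    rw [hk]
  have := mulDist_apply_of_integrable hF (hasFourierDensity_schwartz g)
    (integrable_fracSymbol_mul_angularFourier hα f) (integrable_angularFourier g) h φ
  rwa [angularFourierInv_angularFourier, ← fracDeriv_eq] at this

theorem hirotaDist_schwartz {α : ℝ} (hα : 0 ≤ α) (f g φ : 𝓢(ℝ, ℂ)) :
    Integrable (fun ξ : ℝ => φ ξ * hirota α f g ξ) ∧
      hirotaDist α (f : 𝓢'(ℝ, ℂ)) (g : 𝓢'(ℝ, ℂ)) φ = ∫ ξ : ℝ, φ ξ * hirota α f g ξ := by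
  obtain ⟨h1, h2⟩ := mulDist_fracDerivDist_schwartz hα f g φ
  obtain ⟨h3, h4⟩ := mulDist_fracDerivDist_schwartz hα g f φ
  have e : (fun ξ : ℝ => φ ξ * hirota α f g ξ) = fun ξ =>
      φ ξ * (fracDeriv α f ξ * g ξ) - φ ξ * (fracDeriv α g ξ * f ξ) := by
    ext ξ; simp only [hirota]; ring
  rw [e, hirotaDist, mulDist_comm (f : 𝓢'(ℝ, ℂ))]
  refine ⟨h1.sub h3, ?_⟩
  rw [integral_sub h1 h3, ← h2, ← h4]
  rfl

theorem integrable_fracDeriv_integrand {α : ℝ} (hα : 0 ≤ α) (f : 𝓢(ℝ, ℂ)) (ξ : ℝ) :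
    Integrable fun k : ℝ =>
      fracSymbol α k * angularFourier f k * Complex.exp (Complex.I * k * ξ) := by
  refine (integrable_fracSymbol_mul_angularFourier hα f).mul_bdd (c := 1)
    (by fun_prop) (Eventually.of_forall fun k => ?_)
  rw [Complex.norm_exp]
  simp

theorem fracDeriv_add {α : ℝ} (hα : 0 ≤ α) (f g : 𝓢(ℝ, ℂ)) :
    fracDeriv α (f + g) = fracDeriv α f + fracDeriv α g := by
  ext ξ
  simp only [fracDeriv, Pi.add_apply]
  rw [← mul_add, ← integral_add (integrable_fracDeriv_integrand hα f ξ)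
    (integrable_fracDeriv_integrand hα g ξ)]
  congr 1
  refine integral_congr_ae (Eventually.of_forall fun k => ?_)
  simp only [angularFourier_eq, FourierTransform.fourier_add, add_apply]
  ring

theorem fracDeriv_smul (α : ℝ) (c : ℂ) (f : 𝓢(ℝ, ℂ)) :
    fracDeriv α (c • f) = c • fracDeriv α f := by
  ext ξ
  simp only [fracDeriv, Pi.smul_apply, smul_eq_mul]
  rw [mul_left_comm, ← integral_const_mul c]
  congr 1
  refine integral_congr_ae (Eventually.of_forall fun k => ?_)
  simp only [angularFourier_eq, FourierTransform.fourier_smul, smul_apply, smul_eq_mul]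
  ring

theorem hirota_swap (α : ℝ) (f g : 𝓢(ℝ, ℂ)) : hirota α f g = -hirota α g f := by
  ext ξ
  simp only [hirota, Pi.neg_apply]
  ring

theorem hirota_self (α : ℝ) (f : 𝓢(ℝ, ℂ)) : hirota α f f = 0 := by
  ext ξ
  simp only [hirota, Pi.zero_apply]
  ring

theorem isLinearMap_hirota_left {α : ℝ} (hα : 0 ≤ α) (g : 𝓢(ℝ, ℂ)) :
    IsLinearMap ℂ fun f : 𝓢(ℝ, ℂ) => hirota α f g where
  map_add f₁ f₂ := by
    ext ξ
    simp only [hirota, fracDeriv_add hα, Pi.add_apply, add_apply]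
    ring
  map_smul c f := by
    ext ξ
    simp only [hirota, fracDeriv_smul, Pi.smul_apply, smul_apply, smul_eq_mul]
    ring

theorem isLinearMap_hirota_right {α : ℝ} (hα : 0 ≤ α) (f : 𝓢(ℝ, ℂ)) :
    IsLinearMap ℂ fun g : 𝓢(ℝ, ℂ) => hirota α f g := by
  have h := isLinearMap_hirota_left hα f
  constructor
  · intro g₁ g₂
    rw [hirota_swap, h.map_add, neg_add, ← hirota_swap, ← hirota_swap]
  · intro c g
    rw [hirota_swap, h.map_smul, ← smul_neg, ← hirota_swap]

end SpectralHirota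

theorem mainTheorem1 :
    (∀ α : ℝ, 0 < α → α ≤ 1 →
      -- (i) bilinearity on Schwartz functions
      ((∀ g : 𝓢(ℝ, ℂ), IsLinearMap ℂ (fun f : 𝓢(ℝ, ℂ) => hirota α f g)) ∧
        (∀ f : 𝓢(ℝ, ℂ), IsLinearMap ℂ (fun g : 𝓢(ℝ, ℂ) => hirota α f g))) ∧
      -- (ii) skew-symmetry and diagonal vanishing, on Schwartz functions and on Sobolev spaces
      ((∀ f g : 𝓢(ℝ, ℂ), hirota α f g = -hirota α g f) ∧
        (∀ f : 𝓢(ℝ, ℂ), hirota α f f = 0) ∧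
        (∀ s : ℝ, 1 / 2 < s → ∀ f g : 𝓢'(ℝ, ℂ), MemSobolev s 2 f → MemSobolev s 2 g →
          hirotaDist α f g = -hirotaDist α g f ∧ hirotaDist α f f = 0)) ∧
      -- the operator on Sobolev spaces extends the one on Schwartz functions
      (∀ f g φ : 𝓢(ℝ, ℂ), Integrable (fun ξ : ℝ => φ ξ * hirota α f g ξ) ∧
        hirotaDist α (f : 𝓢'(ℝ, ℂ)) (g : 𝓢'(ℝ, ℂ)) φ = ∫ ξ : ℝ, φ ξ * hirota α f g ξ) ∧
      -- (iii) Sobolev continuity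
      (∀ s : ℝ, 1 / 2 < s → ∃ C : ℝ, ∀ f g : 𝓢'(ℝ, ℂ), MemSobolev s 2 f → MemSobolev s 2 g →
        MemSobolev (s - α) 2 (hirotaDist α f g) ∧
          sobolevNorm (s - α) (hirotaDist α f g) ≤ C * sobolevNorm s f * sobolevNorm s g)) ∧
    -- (iv) classical limit
    (∀ s : ℝ, 1 / 2 < s → ∀ f g : 𝓢'(ℝ, ℂ), MemSobolev s 2 f → MemSobolev s 2 g →
      (∀ α : ℝ, 0 < α → α ≤ 1 → MemSobolev (s - 1) 2 (hirotaDist α f g)) ∧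
      MemSobolev (s - 1) 2 (classicalHirota f g) ∧
      Tendsto (fun α : ℝ => sobolevNorm (s - 1) (hirotaDist α f g - classicalHirota f g))
        (𝓝[<] 1) (𝓝 0)) := by
  refine ⟨fun α hα hα1 => ⟨⟨isLinearMap_hirota_left hα.le, isLinearMap_hirota_right hα.le⟩,
    ⟨hirota_swap α, hirota_self α, fun s _ f g _ _ => ⟨hirotaDist_swap α f g, hirotaDist_self α f⟩⟩,
    hirotaDist_schwartz hα.le, fun s hs => ?_⟩, fun s hs f g hf hg => ⟨fun α hα hα1 => ?_, ?_,
      tendsto_sobolevNorm_hirotaDist_sub hs hf hg⟩⟩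
  · obtain ⟨C, hC⟩ := exists_sobolevNorm_hirotaDist_le hs hα.le hα1
    exact ⟨C, fun f g hf hg => ⟨memSobolev_hirotaDist hs hα.le hα1 hf hg, hC f g hf hg⟩⟩
  · exact (memSobolev_hirotaDist hs hα.le hα1 hf hg).mono (by linarith)
  · rw [classicalHirota_eq hf hg]
    exact memSobolev_hirotaDist hs zero_le_one le_rfl hf hg
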